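/- Consider terms with explicit substitutions, $t,u ::= x \mid \lambda x.t \mid t\,u \mid t[x{\leftarrow}u]$ (where both $\lambda x.t$ and $t[x{\leftarrow}u]$ bind $x$ in $t$), up to $\alpha$-equivalence; a $\lambda$-term is a term without explicit substitutions. The unfolding $t{\downarrow}$ of $t$ is the $\lambda$-term obtained by turning each explicit substitution into a meta-level one: $(t[x{\leftarrow}u]){\downarrow} = t{\downarrow}\{x{\leftarrow}u{\downarrow}\}$. Shallow contexts are $C ::= \langle\cdot\rangle \mid \lambda x.C \mid C\,t \mid t\,C \mid C[x{\leftarrow}t]$ and substitution contexts are $L ::= \langle\cdot\rangle \mid L[x{\leftarrow}t]$. A context is applicative if it has the form $C\langle L\,t\rangle$. The unfolding $t{\downarrow}_C$ of $t$ relative to $C$ is given by $t{\downarrow}_{\langle\cdot\rangle} = t{\downarrow}$, $t{\downarrow}_{\lambda x.C} = t{\downarrow}_{u\,C} = t{\downarrow}_{C\,u} = t{\downarrow}_C$ and $t{\downarrow}_{C[x{\leftarrow}u]} = t{\downarrow}_C\{x{\leftarrow}u{\downarrow}\}$ (bound names being distinct from all other names). Reduction $\to$ is the union of the following steps, where $C,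 D$ are shallow: $$C\langle L\langle\lambda x.s\rangle u\rangle \to_{dB} C\langle L\langle s[x{\leftarrow}u]\rangle\rangle,\qquad D\langle C\langle x\rangle[x{\leftarrow}u]\rangle \to_{ls} D\langle C\langle u\rangle[x{\leftarrow}u]\rangle,$$ up to capture-avoidance ($C$ does not capture $x$ in the second rule). The position of the $dB$-step is $C$; that of the substitution ($ls$-) step is $D\langle C[x{\leftarrow}u]\rangle$, so that an $ls$-step of position $E$ has the compact form $E\langle x\rangle \to_{ls} E\langle u\rangle$. A step is useful if it is a $dB$-step, or an $ls$-step $E\langle x\rangle\to_{ls}E\langle u\rangle$ such that $u{\downarrow}_E$ contains a $\beta$-redex, or $u{\downarrow}_E$ is an abstraction and $E$ is applicative. Contexts are ordered by the left-to-right outside-in order: $C \prec_{LO} D$ if $D = C\langle E\rangle$ with $E\neq\langle\cdot\rangle$, or if $C = F\langle C'\,u\rangle$ and $D=F\langle t\,D'\rangle$ where $C'$ is a prefix of $t$ and $D'$ a prefix of $u$ (a context $C$ is a prefix of $t$ if $t=C\langle r\rangle$ for some $r$). A LOU step is the reduction of the useful redex whose position precedes, for $\prec_{LO}$, the positions of all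 other useful redexes of the term. LO$\beta$-reduction on $\lambda$-terms is the reduction of the $\prec_{LO}$-least $\beta$-redex. A derivation is a finite sequence of consecutive steps; $|\rho|$ is its length and $|\rho|_{dB}$ its number of $dB$-steps. Two consecutive $ls$-steps are outside-in if they have the compact form $C\langle x\rangle\to_{ls}C\langle D\langle y\rangle\rangle\to_{ls}C\langle D\langle u\rangle\rangle$ (of positions $C$ and $C\langle D\rangle$), and a derivation is outside-in if any two consecutive $ls$-steps of it are. A derivation from $t$ has the subterm property if every term duplicated by one of its $ls$-steps is a subterm of $t$, up to the names of (free and bound) variables. Then the following hold. 1. Every LOU derivation, starting from an arbitrary term, is outside-in. 2. Let $t$ be a $\lambda$-term and let $\rho : t \to^n u \to_{ls}^k r$ be a derivation with the subterm property whose suffix $u\to_{ls}^k r$ is outside-in. Then $k\le|\rho|_{dB}$. 3. (Local boundedness) Let $t$ be a $\lambda$-term and let $\rho$ be a LOU derivation from $t$ to $u$. Every sequence of LOU steps from $u$ consisting only of $ls$-steps has length at most $|\rho|_{dB}$. 4. (Quadratic overhead) Let $t$ be a $\lambda$-term and let $\rho$ be a LOU derivation from $t$ to $u$. Then $t$ reduces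 to $u{\downarrow}$ in exactly $|\rho|_{dB}$ steps of LO$\beta$-reduction, and $|\rho|\le|\rho|_{dB}+|\rho|_{dB}^2$. -/

import Mathlib

namespace LSC

/-! ## Terms with explicit substitutions, up to alpha-equivalence (de Bruijn indices) -/

/-- Terms of the linear substitution calculus. `lam t` binds index `0` in `t`, and
`sub t u` is the explicit substitution `t[x ← u]`, binding index `0` in `t` but not in `u`.
Indices pointing outside all binders are the free variables. -/
inductive Term : Type
  | var (n : ℕ) : Term
  | lam (t : Term) : Term
  | app (t u : Term) : Term
  | sub (t u : Term) : Term

/-- The ordinary lambda-terms are the terms without explicit substitutions. -/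
def Term.IsLambda : Term → Prop
  | .var _ => True
  | .lam t => t.IsLambda
  | .app t u => t.IsLambda ∧ u.IsLambda
  | .sub _ _ => False

/-- A renaming extended under one binder. -/
def upRen (ξ : ℕ → ℕ) : ℕ → ℕ
  | 0 => 0
  | n + 1 => ξ n + 1

def Term.rename : (ℕ → ℕ) → Term → Term
  | ξ, .var n => .var (ξ n)
  | ξ, .lam t => .lam (t.rename (upRen ξ))
  | ξ, .app t u => .app (t.rename ξ) (u.rename ξ)
  | ξ, .sub t u => .sub (t.rename (upRen ξ)) (u.rename ξ)

/-- Weakening of a term: the same term, seen under `k` more binders. -/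
def Term.shift (k : ℕ) (t : Term) : Term := t.rename (fun n => n + k)

/-- A simultaneous substitution extended under one binder. -/
def up (σ : ℕ → Term) : ℕ → Term
  | 0 => .var 0
  | n + 1 => (σ n).shift 1

/-- Capture-avoiding (meta-level) simultaneous substitution. -/
def Term.subst : (ℕ → Term) → Term → Term
  | σ, .var n => σ n
  | σ, .lam t => .lam (t.subst (up σ))
  | σ, .app t u => .app (t.subst σ) (u.subst σ)
  | σ, .sub t u => .sub (t.subst (up σ)) (u.subst σ)

/-- The substitution of `u` for index `0`, the other indices going down by one. -/
def single (u : Term) : ℕ → Term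
  | 0 => u
  | n + 1 => .var n

/-- `t.substAt k u` is the meta-level substitution of `u` for the variable with index `k` in `t`,
where `t` lives under `k` further binders that are not in scope for `u`. -/
def Term.substAt (k : ℕ) (t u : Term) : Term := t.subst (up^[k] (single u))

/-- The unfolding of a term, obtained by turning explicit substitutions into meta-level ones. -/
def Term.unfold : Term → Term
  | .var n => .var n
  | .lam t => .lam t.unfold
  | .app t u => .app t.unfold u.unfold
  | .sub t u => t.unfold.substAt 0 u.unfold

/-! ## Shallow contexts -/

/-- Shallow one-hole contexts: the hole is never inside the content of an explicit substitution. -/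
inductive Ctx : Type
  | hole : Ctx
  | lam (C : Ctx) : Ctx
  | appL (C : Ctx) (t : Term) : Ctx
  | appR (t : Term) (C : Ctx) : Ctx
  | sub (C : Ctx) (t : Term) : Ctx

/-- Plugging a term into a context (variables may be captured). -/
def Ctx.plug : Ctx → Term → Term
  | .hole, s => s
  | .lam C, s => .lam (C.plug s)
  | .appL C t, s => .app (C.plug s) t
  | .appR t C, s => .app t (C.plug s)
  | .sub C t, s => .sub (C.plug s) t

/-- Plugging a context into a context. -/
def Ctx.comp : Ctx → Ctx → Ctx
  | .hole, D => D
  | .lam C, D => .lam (C.comp D)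
  | .appL C t, D => .appL (C.comp D) t
  | .appR t C, D => .appR t (C.comp D)
  | .sub C t, D => .sub (C.comp D) t

/-- The number of binders (abstractions and explicit substitutions) above the hole. -/
def Ctx.depth : Ctx → ℕ
  | .hole => 0
  | .lam C => C.depth + 1
  | .appL C _ => C.depth
  | .appR _ C => C.depth
  | .sub C _ => C.depth + 1

/-- The number of abstractions above the hole. -/
def Ctx.lamDepth : Ctx → ℕ
  | .hole => 0
  | .lam C => C.lamDepth + 1
  | .appL C _ => C.lamDepth
  | .appR _ C => C.lamDepth
  | .sub C _ => C.lamDepth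

/-- Substitution contexts `L ::= ⟨·⟩ | L[x ← t]`. -/
def Ctx.IsSubst : Ctx → Prop
  | .hole => True
  | .sub L _ => L.IsSubst
  | _ => False

/-- Applicative contexts `A ::= C⟨L t⟩`. -/
def Ctx.IsApplicative (A : Ctx) : Prop :=
  ∃ (C L : Ctx) (t : Term), L.IsSubst ∧ A = C.comp (.appL L t)

/-- The context `C` is a prefix of the term `t`. -/
def Ctx.PrefixOf (C : Ctx) (t : Term) : Prop := ∃ u, C.plug u = t

/-- The unfolding of a term `t` relative to a context `C`. The variables bound by abstractions of
`C` stay variables of the result, which thus lives under `C.lamDepth` abstractions; in the last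
clause the variable bound by the explicit substitution is therefore the one with
index `C.lamDepth`. -/
def relUnfold (t : Term) : Ctx → Term
  | .hole => t.unfold
  | .lam C => relUnfold t C
  | .appL C _ => relUnfold t C
  | .appR _ C => relUnfold t C
  | .sub C u => (relUnfold t C).substAt C.lamDepth u.unfold

/-! ## The left-to-right outside-in order -/

/-- The outside-in order on contexts. -/
inductive OutsideInOrder : Ctx → Ctx → Prop
  | root {C : Ctx} : C ≠ .hole → OutsideInOrder .hole C
  | closure {C D : Ctx} (E : Ctx) : OutsideInOrder C D → OutsideInOrder (E.comp C) (E.comp D)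

/-- The left-to-right order on shallow contexts. -/
inductive LeftToRightOrder : Ctx → Ctx → Prop
  | app {C D : Ctx} {t u : Term} : C.PrefixOf t → D.PrefixOf u →
      LeftToRightOrder (.appL C u) (.appR t D)
  | closure {C D : Ctx} (E : Ctx) : LeftToRightOrder C D → LeftToRightOrder (E.comp C) (E.comp D)

/-- The left-to-right outside-in order. -/
def LOOrder (C D : Ctx) : Prop := OutsideInOrder C D ∨ LeftToRightOrder C D

/-! ## Beta-reduction on lambda-terms -/

/-- `BetaStep C t u`: the term `t` reduces to `u` by the beta-redex of position `C`. On
lambda-terms, every one-hole context is shallow. -/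
inductive BetaStep : Ctx → Term → Term → Prop
  | mk (C : Ctx) (s u : Term) :
      BetaStep C (C.plug (.app (.lam s) u)) (C.plug (s.substAt 0 u))

def HasBetaRedex (t : Term) : Prop := ∃ C u, BetaStep C t u

/-- Leftmost-outermost beta-reduction. -/
def LOBetaStep (t u : Term) : Prop :=
  ∃ C, BetaStep C t u ∧ ∀ D u', BetaStep D t u' → D ≠ C → LOOrder C D

/-- `k` steps of leftmost-outermost beta-reduction. -/
def LOBetaSteps : ℕ → Term → Term → Prop
  | 0, t, u => t = u
  | k + 1, t, u => ∃ r, LOBetaStep t r ∧ LOBetaSteps k r u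

/-! ## Shallow reduction in the linear substitution calculus -/

inductive Kind : Type
  | dB : Kind
  | ls : Kind

/-- The data of a reduction step: its kind, its position, its source and its target. -/
structure Step : Type where
  kind : Kind
  pos : Ctx
  src : Term
  tgt : Term

/-- The (shallow) reduction steps:
* `C⟨L⟨λx.s⟩ u⟩ →dB C⟨L⟨s[x ← u]⟩⟩`, of position `C`;
* `D⟨C⟨x⟩[x ← u]⟩ →ls D⟨C⟨u⟩[x ← u]⟩`, of position `D⟨C[x ← u]⟩`. -/
inductive IsStep : Step → Prop
  | dB (C L : Ctx) (s u : Term) : L.IsSubst →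
      IsStep ⟨.dB, C, C.plug (.app (L.plug (.lam s)) u),
        C.plug (L.plug (.sub s (u.shift L.depth)))⟩
  | ls (D C : Ctx) (u : Term) :
      IsStep ⟨.ls, D.comp (.sub C u), (D.comp (.sub C u)).plug (.var C.depth),
        (D.comp (.sub C u)).plug (u.shift (C.depth + 1))⟩

/-- Useful steps: all `dB`-steps, and the `ls`-steps `C⟨x⟩ → C⟨r⟩` (in compact form) for which
the unfolding of `r` relative to `C` has a beta-redex, or is an abstraction with `C`
applicative. -/
inductive IsUseful : Step → Prop
  | dB {s : Step} : IsStep s → s.kind = .dB → IsUseful s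
  | ls {s : Step} (r : Term) : IsStep s → s.kind = .ls → s.tgt = s.pos.plug r →
      (HasBetaRedex (relUnfold r s.pos) ∨
        ((∃ q, relUnfold r s.pos = .lam q) ∧ s.pos.IsApplicative)) →
      IsUseful s

/-- Leftmost-outermost useful steps: those that reduce the useful redex preceding every other
useful redex of the same term. -/
def IsLOU (s : Step) : Prop :=
  IsUseful s ∧ ∀ s' : Step, IsUseful s' → s'.src = s.src → s'.pos ≠ s.pos → LOOrder s.pos s'.pos

/-! ## Derivations -/

/-- `IsDerivation P t ρ u`: the list `ρ` is a derivation from `t` to `u`, made of steps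
satisfying `P`. -/
def IsDerivation (P : Step → Prop) : Term → List Step → Term → Prop
  | t, [], u => t = u
  | t, s :: ρ, u => s.src = t ∧ P s ∧ IsDerivation P s.tgt ρ u

/-- The number of `dB`-steps of a derivation. -/
def dBCount : List Step → ℕ
  | [] => 0
  | ⟨.dB, _, _, _⟩ :: ρ => dBCount ρ + 1
  | ⟨.ls, _, _, _⟩ :: ρ => dBCount ρ

/-- All steps of the sequence are substitution steps. -/
def AllLs (ρ : List Step) : Prop := ∀ s ∈ ρ, s.kind = .ls

/-- Two substitution steps are outside-in if they have the compact form
`C⟨x⟩ →ls C⟨D⟨y⟩⟩ →ls C⟨D⟨u⟩⟩`, of positions `C` and `C⟨D⟩`. -/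
def OutsideInPair (s s' : Step) : Prop :=
  ∃ (C D : Ctx) (x y : ℕ) (u : Term),
    s = ⟨.ls, C, C.plug (.var x), C.plug (D.plug (.var y))⟩ ∧
    s' = ⟨.ls, C.comp D, C.plug (D.plug (.var y)), C.plug (D.plug u)⟩

/-- A derivation is outside-in if any two consecutive substitution steps are. -/
def IsOutsideIn (ρ : List Step) : Prop :=
  ρ.IsChain (fun s s' => s.kind = .ls → s'.kind = .ls → OutsideInPair s s')

/-- Replaces all variables by a fixed one (binders carry no names here). -/
def Term.eraseVars : Term → Term
  | .var _ => .var 0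
  | .lam t => .lam t.eraseVars
  | .app t u => .app t.eraseVars u.eraseVars
  | .sub t u => .sub t.eraseVars u.eraseVars

/-- `Subterm u t`: the term `u` occurs syntactically in `t`. -/
inductive Subterm : Term → Term → Prop
  | refl (t : Term) : Subterm t t
  | lam {u t : Term} : Subterm u t → Subterm u (.lam t)
  | appL {u t : Term} (r : Term) : Subterm u t → Subterm u (.app t r)
  | appR {u t : Term} (r : Term) : Subterm u t → Subterm u (.app r t)
  | subL {u t : Term} (r : Term) : Subterm u t → Subterm u (.sub t r)
  | subR {u t : Term} (r : Term) : Subterm u t → Subterm u (.sub r t)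

/-- The subterm property of a derivation `ρ` starting from `t`: every term duplicated by a
substitution step of `ρ` is a subterm of `t`, up to the names of the variables. -/
def SubtermProperty (t : Term) (ρ : List Step) : Prop :=
  ∀ s ∈ ρ, s.kind = .ls → ∀ r, s.tgt = s.pos.plug r → Subterm r.eraseVars t.eraseVars

end LSC

/-! Unfolding relative to a context amounts to applying a substitution, the environment supplied by
the context, to the unfolded term (`relUnfold_eq`). Usefulness of an `ls`-step thus becomes a
condition on the value of one variable, and leftmost-outermost useful reduction becomes a
syntax-directed relation, `LOUAt`.

A term without useful redexes unfolds to a normal form, and to no abstraction if it is in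
applicative position and not an answer (`Env.Compat.normal_of_no_useful`). So whatever an LOU step
leaves on its left is normal after unfolding: `dB`-steps project to LOβ-steps, while `ls`-steps do
not change the unfolding. As the unfolding of a function part survives an `ls`-step, a redex that
made it useful cannot vanish, and the next `ls`-step must occur inside the copy just made: LOU
derivations are outside-in.

For the bounds, the start is a λ-term and copied terms are its subterms (`Inv` is the invariant),
hence free of explicit substitutions. So a reachable term has exactly as many explicit substitutions
as there were `dB`-steps. In an outside-in sequence each `ls`-step uses a substitution strictly
outside the previous one on a fixed path, so its length is at most that number. Summing over the
blocks between `dB`-steps gives the quadratic bound. -/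

namespace LSC

/-! ## Algebra of renamings and substitutions -/

/-- The simultaneous substitution of `u` for index `0` and of `σ` for the others. -/
def consSubst (u : Term) (σ : ℕ → Term) : ℕ → Term
  | 0 => u
  | n + 1 => σ n

theorem upRen_comp (ξ ζ : ℕ → ℕ) : upRen ξ ∘ upRen ζ = upRen (ξ ∘ ζ) := by
  funext n; cases n <;> rfl

theorem Term.rename_rename (t : Term) : ∀ ξ ζ : ℕ → ℕ,
    (t.rename ζ).rename ξ = t.rename (ξ ∘ ζ) := by
  induction t with
  | var n => intros; rfl
  | lam t ih => intros; simp only [Term.rename, ih, upRen_comp]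
  | app t u iht ihu => intros; simp only [Term.rename, iht, ihu]
  | sub t u iht ihu => intros; simp only [Term.rename, iht, ihu, upRen_comp]

theorem Term.shift_shift (t : Term) (j k : ℕ) : (t.shift j).shift k = t.shift (j + k) := by
  simp only [Term.shift, Term.rename_rename]
  congr 1; funext n; simp [Nat.add_assoc]

theorem up_comp_upRen (σ : ℕ → Term) (ξ : ℕ → ℕ) : up σ ∘ upRen ξ = up (σ ∘ ξ) := by
  funext n; cases n <;> rfl

theorem Term.subst_rename (t : Term) : ∀ (σ : ℕ → Term) (ξ : ℕ → ℕ),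
    (t.rename ξ).subst σ = t.subst (σ ∘ ξ) := by
  induction t with
  | var n => intros; rfl
  | lam t ih => intros; simp only [Term.rename, Term.subst, ih, up_comp_upRen]
  | app t u iht ihu => intros; simp only [Term.rename, Term.subst, iht, ihu]
  | sub t u iht ihu => intros; simp only [Term.rename, Term.subst, iht, ihu, up_comp_upRen]

theorem up_rename (σ : ℕ → Term) (ξ : ℕ → ℕ) :
    (fun n => (up σ n).rename (upRen ξ)) = up (fun n => (σ n).rename ξ) := by
  funext n
  cases n with
  | zero => rfl
  | succ n =>
    simp only [up, Term.shift, Term.rename_rename]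
    congr 1

theorem Term.rename_subst (t : Term) : ∀ (σ : ℕ → Term) (ξ : ℕ → ℕ),
    (t.subst σ).rename ξ = t.subst (fun n => (σ n).rename ξ) := by
  induction t with
  | var n => intros; rfl
  | lam t ih => intros; simp only [Term.rename, Term.subst, ih, up_rename]
  | app t u iht ihu => intros; simp only [Term.rename, Term.subst, iht, ihu]
  | sub t u iht ihu => intros; simp only [Term.rename, Term.subst, iht, ihu, up_rename]

theorem up_subst (σ τ : ℕ → Term) :
    (fun n => (up σ n).subst (up τ)) = up (fun n => (σ n).subst τ) := by
  funext n
  cases n with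
  | zero => rfl
  | succ n =>
    simp only [up, Term.shift, Term.subst_rename, Term.rename_subst]
    congr 1

theorem Term.subst_subst (t : Term) : ∀ σ τ : ℕ → Term,
    (t.subst σ).subst τ = t.subst (fun n => (σ n).subst τ) := by
  induction t with
  | var n => intros; rfl
  | lam t ih => intros; simp only [Term.subst, ih, up_subst]
  | app t u iht ihu => intros; simp only [Term.subst, iht, ihu]
  | sub t u iht ihu => intros; simp only [Term.subst, iht, ihu, up_subst]

theorem up_var : up Term.var = Term.var := by
  funext n; cases n <;> rfl

theorem Term.subst_var (t : Term) : t.subst Term.var = t := by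
  induction t with
  | var n => rfl
  | lam t ih => simp only [Term.subst, up_var, ih]
  | app t u iht ihu => simp only [Term.subst, iht, ihu]
  | sub t u iht ihu => simp only [Term.subst, up_var, iht, ihu]

theorem Term.subst_up_subst_single (t u : Term) (σ : ℕ → Term) :
    (t.subst (up σ)).subst (single u) = t.subst (consSubst u σ) := by
  rw [Term.subst_subst]
  congr 1; funext n
  cases n with
  | zero => rfl
  | succ n =>
    simp only [up, Term.shift, Term.subst_rename, consSubst]
    exact (σ n).subst_var

theorem single_subst (u : Term) (σ : ℕ → Term) :
    (fun n => (single u n).subst σ) = consSubst (u.subst σ) σ := by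
  funext n; cases n <;> rfl

theorem up_iterate_subst (d : ℕ) : ∀ σ τ : ℕ → Term,
    (fun n => (up^[d] σ n).subst (up^[d] τ)) = up^[d] (fun n => (σ n).subst τ) := by
  induction d with
  | zero => intros; rfl
  | succ d ih => intros; simp only [Function.iterate_succ, Function.comp, ih, up_subst]

theorem up_iterate_var (d : ℕ) : up^[d] Term.var = Term.var := by
  induction d with
  | zero => rfl
  | succ d ih => simp only [Function.iterate_succ, Function.comp, up_var, ih]

theorem Term.unfold_rename (t : Term) : ∀ ξ : ℕ → ℕ,
    (t.rename ξ).unfold = t.unfold.rename ξ := by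
  induction t with
  | var n => intros; rfl
  | lam t ih => intros; simp only [Term.rename, Term.unfold, ih]
  | app t u iht ihu => intros; simp only [Term.rename, Term.unfold, iht, ihu]
  | sub t u iht ihu =>
    intro ξ
    simp only [Term.rename, Term.unfold, iht, ihu, Term.substAt, Function.iterate_zero, id,
      Term.subst_rename, Term.rename_subst]
    congr 1; funext n
    cases n <;> rfl

theorem Term.IsLambda.unfold_eq {t : Term} (h : t.IsLambda) : t.unfold = t := by
  induction t with
  | var n => rfl
  | lam t ih => simp only [Term.unfold, ih h]
  | app t u iht ihu => simp only [Term.unfold, iht h.1, ihu h.2]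
  | sub t u => exact h.elim

/-! ## Contexts -/

theorem Ctx.plug_comp (C D : Ctx) (t : Term) : (C.comp D).plug t = C.plug (D.plug t) := by
  induction C <;> simp_all [Ctx.comp, Ctx.plug]

theorem Ctx.comp_assoc (C D E : Ctx) : (C.comp D).comp E = C.comp (D.comp E) := by
  induction C <;> simp_all [Ctx.comp]

theorem Ctx.comp_hole (C : Ctx) : C.comp .hole = C := by
  induction C <;> simp_all [Ctx.comp]

theorem Ctx.plug_injective (C : Ctx) {t u : Term} (h : C.plug t = C.plug u) : t = u := by
  induction C <;> simp_all [Ctx.plug]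

theorem Ctx.depth_comp (C D : Ctx) : (C.comp D).depth = C.depth + D.depth := by
  induction C <;> simp_all [Ctx.comp, Ctx.depth] <;> omega

theorem Ctx.isApplicative_hole : ¬ Ctx.hole.IsApplicative := by
  rintro ⟨C, L, t, -, h⟩; cases C <;> simp [Ctx.comp] at h

theorem Ctx.isApplicative_lam {C : Ctx} : (Ctx.lam C).IsApplicative ↔ C.IsApplicative := by
  constructor
  · rintro ⟨D, L, t, hL, h⟩
    cases D <;> simp only [Ctx.comp, Ctx.lam.injEq, reduceCtorEq] at h
    exact ⟨_, _, _, hL, h⟩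
  · rintro ⟨D, L, t, hL, rfl⟩; exact ⟨.lam D, L, t, hL, rfl⟩

theorem Ctx.isApplicative_appR {C : Ctx} {u : Term} :
    (Ctx.appR u C).IsApplicative ↔ C.IsApplicative := by
  constructor
  · rintro ⟨D, L, t, hL, h⟩
    cases D <;> simp only [Ctx.comp, Ctx.appR.injEq, reduceCtorEq] at h
    exact ⟨_, _, _, hL, h.2⟩
  · rintro ⟨D, L, t, hL, rfl⟩; exact ⟨.appR u D, L, t, hL, rfl⟩

theorem Ctx.isApplicative_sub {C : Ctx} {u : Term} :
    (Ctx.sub C u).IsApplicative ↔ C.IsApplicative := by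
  constructor
  · rintro ⟨D, L, t, hL, h⟩
    cases D <;> simp only [Ctx.comp, Ctx.sub.injEq, reduceCtorEq] at h
    exact ⟨_, _, _, hL, h.1⟩
  · rintro ⟨D, L, t, hL, rfl⟩; exact ⟨.sub D u, L, t, hL, rfl⟩

theorem Ctx.isApplicative_appL {C : Ctx} {u : Term} :
    (Ctx.appL C u).IsApplicative ↔ C.IsApplicative ∨ C.IsSubst := by
  constructor
  · rintro ⟨D, L, t, hL, h⟩
    cases D <;> simp only [Ctx.comp, Ctx.appL.injEq, reduceCtorEq] at h
    · exact .inr (h.1 ▸ hL)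
    · exact .inl ⟨_, _, _, hL, h.1⟩
  · rintro (⟨D, L, t, hL, rfl⟩ | h)
    · exact ⟨.appL D u, L, t, hL, rfl⟩
    · exact ⟨.hole, C, u, h, rfl⟩

/-- Whether `C` is applicative, when it is itself placed in a context that is applicative
according to `a`. -/
def Ctx.flag : Bool → Ctx → Bool
  | a, .hole => a
  | _, .lam C => C.flag false
  | _, .appL C _ => C.flag true
  | _, .appR _ C => C.flag false
  | a, .sub C _ => C.flag a

/-- Applicativity is decided by the innermost constructor above the hole that is not an explicit
substitution, and substitutions are transparent. The Boolean carries this information downwards,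
which suits inductions on terms. -/
theorem Ctx.flag_eq_true (C : Ctx) : ∀ a : Bool,
    C.flag a = true ↔ C.IsApplicative ∨ (C.IsSubst ∧ a = true) := by
  induction C with
  | hole => intro a; simp [Ctx.flag, Ctx.isApplicative_hole, Ctx.IsSubst]
  | lam C ih => intro a; simp [Ctx.flag, Ctx.isApplicative_lam, ih, Ctx.IsSubst]
  | appL C u ih => intro a; simp [Ctx.flag, Ctx.isApplicative_appL, ih, Ctx.IsSubst]
  | appR u C ih => intro a; simp [Ctx.flag, Ctx.isApplicative_appR, ih, Ctx.IsSubst]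
  | sub C u ih => intro a; simp [Ctx.flag, Ctx.isApplicative_sub, ih, Ctx.IsSubst]

/-! ## The left-to-right outside-in order -/

theorem outsideInOrder_iff {C D : Ctx} :
    OutsideInOrder C D ↔ ∃ E, E ≠ Ctx.hole ∧ D = C.comp E := by
  constructor
  · intro h
    induction h with
    | @root D h => exact ⟨D, h, rfl⟩
    | closure E _ ih =>
      obtain ⟨F, hF, rfl⟩ := ih
      exact ⟨F, hF, (Ctx.comp_assoc _ _ _).symm⟩
  · rintro ⟨E, hE, rfl⟩
    simpa [Ctx.comp_hole] using OutsideInOrder.closure C (OutsideInOrder.root hE)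

theorem leftToRightOrder_iff {C D : Ctx} :
    LeftToRightOrder C D ↔ ∃ (F C' D' : Ctx) (t u : Term), C'.PrefixOf t ∧ D'.PrefixOf u ∧
      C = F.comp (.appL C' u) ∧ D = F.comp (.appR t D') := by
  constructor
  · intro h
    induction h with
    | app hC hD => exact ⟨.hole, _, _, _, _, hC, hD, rfl, rfl⟩
    | closure E _ ih =>
      obtain ⟨F, C', D', t, u, hC, hD, rfl, rfl⟩ := ih
      exact ⟨E.comp F, C', D', t, u, hC, hD, (Ctx.comp_assoc _ _ _).symm,
        (Ctx.comp_assoc _ _ _).symm⟩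
  · rintro ⟨F, C', D', t, u, hC, hD, rfl, rfl⟩
    exact .closure F (.app hC hD)

theorem LOOrder.closure {C D : Ctx} (E : Ctx) (h : LOOrder C D) :
    LOOrder (E.comp C) (E.comp D) :=
  h.imp (.closure E) (.closure E)

theorem LOOrder.ne_hole {C D : Ctx} (h : LOOrder C D) : D ≠ .hole := by
  rintro rfl
  rcases h with h | h
  · obtain ⟨E, hE, h⟩ := outsideInOrder_iff.1 h
    cases C <;> simp [Ctx.comp] at h
    exact hE h.symm
  · obtain ⟨F, C', D', t, u, -, -, -, h⟩ := leftToRightOrder_iff.1 h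
    cases F <;> simp [Ctx.comp] at h

/-- If the least useful redex lies in an argument, this excludes every useful redex from the
function part. -/
theorem not_LOOrder_appR_appL {C D : Ctx} {t u : Term} :
    ¬ LOOrder (.appR t C) (.appL D u) := by
  rintro (h | h)
  · obtain ⟨E, hE, h⟩ := outsideInOrder_iff.1 h
    simp [Ctx.comp] at h
  · obtain ⟨F, C', D', t, u, -, -, h, h'⟩ := leftToRightOrder_iff.1 h
    cases F <;> simp [Ctx.comp] at h h'

theorem LOOrder.of_lam {C D : Ctx} (h : LOOrder (.lam C) (.lam D)) : LOOrder C D := by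
  rcases h with h | h
  · obtain ⟨E, hE, h⟩ := outsideInOrder_iff.1 h
    simp only [Ctx.comp, Ctx.lam.injEq] at h
    exact .inl (outsideInOrder_iff.2 ⟨E, hE, h⟩)
  · obtain ⟨F, C', D', t, u, hC, hD, h, h'⟩ := leftToRightOrder_iff.1 h
    cases F <;> simp only [Ctx.comp, Ctx.lam.injEq, reduceCtorEq] at h h'
    exact .inr (leftToRightOrder_iff.2 ⟨_, C', D', t, u, hC, hD, h, h'⟩)

theorem LOOrder.of_appL {C D : Ctx} {v w : Term} (h : LOOrder (.appL C v) (.appL D w)) :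
    LOOrder C D := by
  rcases h with h | h
  · obtain ⟨E, hE, h⟩ := outsideInOrder_iff.1 h
    simp only [Ctx.comp, Ctx.appL.injEq] at h
    exact .inl (outsideInOrder_iff.2 ⟨E, hE, h.1⟩)
  · obtain ⟨F, C', D', t, u, hC, hD, h, h'⟩ := leftToRightOrder_iff.1 h
    cases F <;> simp only [Ctx.comp, Ctx.appL.injEq, reduceCtorEq] at h h'
    exact .inr (leftToRightOrder_iff.2 ⟨_, C', D', t, u, hC, hD, h.1, h'.1⟩)

theorem LOOrder.of_appR {C D : Ctx} {v w : Term} (h : LOOrder (.appR v C) (.appR w D)) :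
    LOOrder C D := by
  rcases h with h | h
  · obtain ⟨E, hE, h⟩ := outsideInOrder_iff.1 h
    simp only [Ctx.comp, Ctx.appR.injEq] at h
    exact .inl (outsideInOrder_iff.2 ⟨E, hE, h.2⟩)
  · obtain ⟨F, C', D', t, u, hC, hD, h, h'⟩ := leftToRightOrder_iff.1 h
    cases F <;> simp only [Ctx.comp, Ctx.appR.injEq, reduceCtorEq] at h h'
    exact .inr (leftToRightOrder_iff.2 ⟨_, C', D', t, u, hC, hD, h.2, h'.2⟩)

theorem LOOrder.of_sub {C D : Ctx} {v w : Term} (h : LOOrder (.sub C v) (.sub D w)) :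
    LOOrder C D := by
  rcases h with h | h
  · obtain ⟨E, hE, h⟩ := outsideInOrder_iff.1 h
    simp only [Ctx.comp, Ctx.sub.injEq] at h
    exact .inl (outsideInOrder_iff.2 ⟨E, hE, h.1⟩)
  · obtain ⟨F, C', D', t, u, hC, hD, h, h'⟩ := leftToRightOrder_iff.1 h
    cases F <;> simp only [Ctx.comp, Ctx.sub.injEq, reduceCtorEq] at h h'
    exact .inr (leftToRightOrder_iff.2 ⟨_, C', D', t, u, hC, hD, h.1, h'.1⟩)

/-! ## Beta-redexes and leftmost-outermost beta-reduction, structurally -/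

theorem betaStep_iff {C : Ctx} {t t' : Term} : BetaStep C t t' ↔
    ∃ s u, t = C.plug (.app (.lam s) u) ∧ t' = C.plug (s.substAt 0 u) := by
  constructor
  · rintro ⟨s, u⟩; exact ⟨s, u, rfl, rfl⟩
  · rintro ⟨s, u, rfl, rfl⟩; exact .mk C s u

theorem hasBetaRedex_iff {t : Term} :
    HasBetaRedex t ↔ ∃ (C : Ctx) (s u : Term), t = C.plug (.app (.lam s) u) := by
  constructor
  · rintro ⟨C, _, ⟨s, u⟩⟩; exact ⟨C, s, u, rfl⟩
  · rintro ⟨C, s, u, rfl⟩; exact ⟨C, _, .mk C s u⟩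

theorem not_hasBetaRedex_var (n : ℕ) : ¬ HasBetaRedex (.var n) := by
  rw [hasBetaRedex_iff]
  rintro ⟨C, s, u, h⟩
  cases C <;> simp [Ctx.plug] at h

theorem hasBetaRedex_lam {t : Term} : HasBetaRedex (.lam t) ↔ HasBetaRedex t := by
  simp only [hasBetaRedex_iff]
  constructor
  · rintro ⟨C, s, u, h⟩
    cases C <;> simp only [Ctx.plug, Term.lam.injEq, reduceCtorEq] at h
    exact ⟨_, _, _, h⟩
  · rintro ⟨C, s, u, rfl⟩; exact ⟨.lam C, s, u, rfl⟩

theorem hasBetaRedex_app {t u : Term} :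
    HasBetaRedex (.app t u) ↔ (∃ s, t = .lam s) ∨ HasBetaRedex t ∨ HasBetaRedex u := by
  simp only [hasBetaRedex_iff]
  constructor
  · rintro ⟨C, s, v, h⟩
    cases C <;> simp only [Ctx.plug, Term.app.injEq, reduceCtorEq] at h
    · exact .inl ⟨_, h.1⟩
    · exact .inr (.inl ⟨_, _, _, h.1⟩)
    · exact .inr (.inr ⟨_, _, _, h.2⟩)
  · rintro (⟨s, rfl⟩ | ⟨C, s, v, rfl⟩ | ⟨C, s, v, rfl⟩)
    · exact ⟨.hole, s, u, rfl⟩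
    · exact ⟨.appL C u, s, v, rfl⟩
    · exact ⟨.appR t C, s, v, rfl⟩

/-- Leftmost-outermost beta-reduction, by structural rules. -/
inductive StructLOBeta : Term → Term → Prop
  | beta (s u : Term) : StructLOBeta (.app (.lam s) u) (s.substAt 0 u)
  | lam {t t' : Term} : StructLOBeta t t' → StructLOBeta (.lam t) (.lam t')
  | appL {t t' : Term} (u : Term) : (¬ ∃ s, t = .lam s) → StructLOBeta t t' →
      StructLOBeta (.app t u) (.app t' u)
  | appR {t u u' : Term} : (¬ ∃ s, t = .lam s) → ¬ HasBetaRedex t → StructLOBeta u u' →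
      StructLOBeta (.app t u) (.app t u')

/-- The side conditions of the rules exclude redexes outside or to the left of the contracted one.
The remaining ones are in the same subterm, covered by induction, or in the argument when the
function part reduces. -/
theorem StructLOBeta.loBetaStep {t t' : Term} (h : StructLOBeta t t') : LOBetaStep t t' := by
  induction h with
  | beta s u =>
    exact ⟨.hole, .mk .hole s u, fun D _ _ hD => .inl (.root hD)⟩
  | @lam t t' _ ih =>
    obtain ⟨C, hC, hmin⟩ := ih
    obtain ⟨s, u, rfl, rfl⟩ := betaStep_iff.1 hC
    refine ⟨.lam C, .mk (.lam C) s u, fun D v hD hne => ?_⟩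
    obtain ⟨s', u', h, rfl⟩ := betaStep_iff.1 hD
    cases D <;> simp only [Ctx.plug, Term.lam.injEq, reduceCtorEq] at h
    rename_i D
    exact (hmin D _ (betaStep_iff.2 ⟨s', u', h, rfl⟩) (fun h => hne (h ▸ rfl))).closure
      (.lam .hole)
  | @appL t t' v hlam _ ih =>
    obtain ⟨C, hC, hmin⟩ := ih
    obtain ⟨s, u, rfl, rfl⟩ := betaStep_iff.1 hC
    refine ⟨.appL C v, .mk (.appL C v) s u, fun D w hD hne => ?_⟩
    obtain ⟨s', u', h, rfl⟩ := betaStep_iff.1 hD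
    cases D <;> simp only [Ctx.plug, Term.app.injEq, reduceCtorEq] at h
    · exact (hlam ⟨_, h.1⟩).elim
    · rename_i D w
      obtain ⟨h, rfl⟩ := h
      exact (hmin D _ (betaStep_iff.2 ⟨s', u', h, rfl⟩) (fun h => hne (h ▸ rfl))).closure
        (.appL .hole _)
    · rename_i w D
      obtain ⟨rfl, h⟩ := h
      exact .inr (.app ⟨_, rfl⟩ ⟨_, h.symm⟩)
  | @appR v t t' hlam hnf _ ih =>
    obtain ⟨C, hC, hmin⟩ := ih
    obtain ⟨s, u, rfl, rfl⟩ := betaStep_iff.1 hC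
    refine ⟨.appR v C, .mk (.appR v C) s u, fun D w hD hne => ?_⟩
    obtain ⟨s', u', h, rfl⟩ := betaStep_iff.1 hD
    cases D <;> simp only [Ctx.plug, Term.app.injEq, reduceCtorEq] at h
    · exact (hlam ⟨_, h.1⟩).elim
    · exact (hnf (hasBetaRedex_iff.2 ⟨_, _, _, h.1⟩)).elim
    · rename_i w D
      obtain ⟨rfl, h⟩ := h
      exact (hmin D _ (betaStep_iff.2 ⟨s', u', h, rfl⟩) (fun h => hne (h ▸ rfl))).closure
        (.appR _ .hole)

/-! ## Environments -/

/-- What a context provides for the variables of a term plugged into it: the content of the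
explicit substitution binding the variable (if any), and the unfolding of the variable
relative to the context. -/
structure Env : Type where
  content : ℕ → Option Term
  value : ℕ → Term

/-- The empty environment. -/
def Env.empty : Env := ⟨fun _ => none, Term.var⟩

/-- Extension of the contents by a new binder. -/
def consContent (o : Option Term) (γ : ℕ → Option Term) : ℕ → Option Term
  | 0 => o.map (Term.shift 1)
  | n + 1 => (γ n).map (Term.shift 1)

def Env.lam (e : Env) : Env := ⟨consContent none e.content, up e.value⟩

/-- Contents are weakened but values are not: the explicit substitution still binds in terms,
whereas it has disappeared from the unfoldings. -/
def Env.sub (e : Env) (u : Term) : Env :=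
  ⟨consContent (some u) e.content, consSubst (u.unfold.subst e.value) e.value⟩

/-- The environment provided by a context placed in the environment `e`. -/
def Env.ctx : Env → Ctx → Env
  | e, .hole => e
  | e, .lam C => e.lam.ctx C
  | e, .appL C _ => e.ctx C
  | e, .appR _ C => e.ctx C
  | e, .sub C u => (e.sub u).ctx C

/-- The values of the variables are determined by the contents. -/
structure Env.Compat (e : Env) : Prop where
  some : ∀ n r, e.content n = some r → e.value n = r.unfold.subst e.value
  none : ∀ n, e.content n = none → ∃ m, e.value n = .var m

theorem Env.compat_empty : Env.empty.Compat :=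
  ⟨fun _ _ h => by simp [Env.empty] at h, fun n _ => ⟨n, rfl⟩⟩

theorem Env.Compat.lam {e : Env} (h : e.Compat) : e.lam.Compat := by
  constructor
  · rintro (_ | n) r hr
    · simp [Env.lam, consContent] at hr
    · simp only [Env.lam, consContent, Option.map_eq_some_iff] at hr
      obtain ⟨r, hr, rfl⟩ := hr
      simp only [Env.lam, up, h.some n r hr, Term.shift, Term.unfold_rename, Term.rename_subst,
        Term.subst_rename]
      congr 1
  · rintro (_ | n) hn
    · exact ⟨0, rfl⟩
    · simp only [Env.lam, consContent, Option.map_eq_none_iff] at hn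
      obtain ⟨m, hm⟩ := h.none n hn
      exact ⟨m + 1, by simp [Env.lam, up, hm, Term.shift, Term.rename]⟩

theorem Env.Compat.sub {e : Env} (h : e.Compat) (u : Term) : (e.sub u).Compat := by
  constructor
  · rintro (_ | n) r hr
    · simp only [Env.sub, consContent, Option.map_some, Option.some.injEq] at hr
      subst hr
      simp only [Env.sub, consSubst, Term.shift, Term.unfold_rename, Term.subst_rename]
      congr 1
    · simp only [Env.sub, consContent, Option.map_eq_some_iff] at hr
      obtain ⟨r, hr, rfl⟩ := hr
      simp only [Env.sub, consSubst, Term.shift, Term.unfold_rename, Term.subst_rename,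
        h.some n r hr]
      congr 1
  · rintro (_ | n) hn
    · simp [Env.sub, consContent] at hn
    · simp only [Env.sub, consContent, Option.map_eq_none_iff] at hn
      exact h.none n hn

theorem Env.Compat.ctx (C : Ctx) : ∀ {e : Env}, e.Compat → (e.ctx C).Compat := by
  induction C with
  | hole => exact fun h => h
  | lam C ih => exact fun h => ih h.lam
  | appL C u ih => exact fun h => ih h
  | appR u C ih => exact fun h => ih h
  | sub C u ih => exact fun h => ih (h.sub u)

theorem Env.ctx_comp (C D : Ctx) : ∀ e : Env, e.ctx (C.comp D) = (e.ctx C).ctx D := by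
  induction C <;> simp_all [Ctx.comp, Env.ctx]

theorem Env.ctx_content_add_depth (C : Ctx) : ∀ (e : Env) (n : ℕ),
    (e.ctx C).content (n + C.depth) = (e.content n).map (Term.shift C.depth) := by
  have key : ∀ (C : Ctx) (o : Option Term), (o.map (Term.shift 1)).map (Term.shift C.depth) =
      o.map (Term.shift (C.depth + 1)) := by
    intro C o
    cases o <;> simp [Term.shift_shift, Nat.add_comm]
  induction C with
  | hole =>
    intro e n
    have h0 : Term.shift 0 = id := by
      funext t
      have := t.subst_rename Term.var id
      simp only [Term.subst_var, Function.comp_id] at this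
      exact this
    simp [Env.ctx, Ctx.depth, h0]
  | lam C ih =>
    intro e n
    have := ih e.lam (n + 1)
    simp only [Env.ctx, Ctx.depth, ← key]
    rw [← Nat.add_assoc, Nat.add_right_comm, this]
    rfl
  | appL C u ih => exact ih
  | appR u C ih => exact ih
  | sub C u ih =>
    intro e n
    have := ih (e.sub u) (n + 1)
    simp only [Env.ctx, Ctx.depth, ← key]
    rw [← Nat.add_assoc, Nat.add_right_comm, this]
    rfl

theorem Env.ctx_content_sub (D C : Ctx) (u : Term) (e : Env) :
    (e.ctx (D.comp (.sub C u))).content C.depth = some (u.shift (C.depth + 1)) := by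
  have := Env.ctx_content_add_depth C ((e.ctx D).sub u) 0
  rw [Nat.zero_add] at this
  rw [Env.ctx_comp, Env.ctx, this]
  simp [Env.sub, consContent, Term.shift_shift, Nat.add_comm]

/-- In the empty environment the second alternative is impossible, so a variable with a content
yields an actual `ls`-redex. -/
theorem Env.exists_sub_of_ctx_content (C : Ctx) : ∀ {e : Env} {n : ℕ} {r : Term},
    (e.ctx C).content n = some r →
    (∃ (D C' : Ctx) (u : Term), C = D.comp (.sub C' u) ∧ n = C'.depth) ∨
      ∃ m, n = m + C.depth ∧ (e.content m).isSome := by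
  induction C with
  | hole => intro e n r h; exact .inr ⟨n, rfl, by simp [Env.ctx] at h; simp [h]⟩
  | lam C ih =>
    intro e n r h
    rcases ih h with ⟨D, C', u, rfl, rfl⟩ | ⟨_ | m, rfl, hm⟩
    · exact .inl ⟨.lam D, C', u, rfl, rfl⟩
    · simp [Env.lam, consContent] at hm
    · exact .inr ⟨m, by simp only [Ctx.depth]; omega, by simpa [Env.lam, consContent] using hm⟩
  | appL C v ih =>
    intro e n r h
    rcases ih h with ⟨D, C', u, rfl, rfl⟩ | h
    · exact .inl ⟨.appL D v, C', u, rfl, rfl⟩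
    · exact .inr h
  | appR v C ih =>
    intro e n r h
    rcases ih h with ⟨D, C', u, rfl, rfl⟩ | h
    · exact .inl ⟨.appR v D, C', u, rfl, rfl⟩
    · exact .inr h
  | sub C v ih =>
    intro e n r h
    rcases ih h with ⟨D, C', u, rfl, rfl⟩ | ⟨_ | m, rfl, hm⟩
    · exact .inl ⟨.sub D v, C', u, rfl, rfl⟩
    · exact .inl ⟨.hole, C, v, rfl, by simp⟩
    · exact .inr ⟨m, by simp only [Ctx.depth]; omega, by simpa [Env.sub, consContent] using hm⟩

/-! ### Relative unfolding as unfolding in an environment -/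

theorem Term.unfold_sub_subst (t u : Term) (e : Env) :
    (Term.sub t u).unfold.subst e.value = t.unfold.subst (e.sub u).value := by
  simp only [Term.unfold, Term.substAt, Function.iterate_zero, id, Term.subst_subst,
    single_subst, Env.sub]

/-- The outer environment is arbitrary because the induction on `C` extends it at each binder. It is
lifted under `C.lamDepth` binders, since only the variables of abstractions survive in `relUnfold`.
-/
theorem relUnfold_subst (t : Term) (C : Ctx) : ∀ e : Env,
    (relUnfold t C).subst (up^[C.lamDepth] e.value) = t.unfold.subst (e.ctx C).value := by
  induction C with
  | hole => intro e; rfl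
  | lam C ih => intro e; exact ih e.lam
  | appL C u ih => exact ih
  | appR u C ih => exact ih
  | sub C u ih =>
    intro e
    rw [Env.ctx, ← ih, relUnfold, Term.substAt, Term.subst_subst, Ctx.lamDepth,
      up_iterate_subst, single_subst]
    rfl

theorem relUnfold_eq (t : Term) (C : Ctx) :
    relUnfold t C = t.unfold.subst (Env.empty.ctx C).value := by
  rw [← relUnfold_subst]
  simp only [Env.empty, up_iterate_var, Term.subst_var]

/-! ## Useful redexes, structurally -/

/-- The terms `L⟨λx.s⟩`. -/
def Term.IsAnswer (t : Term) : Prop := ∃ (L : Ctx) (s : Term), L.IsSubst ∧ t = L.plug (.lam s)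

/-- `UsefulAt e a t k C t'`: in a context with environment `e`, applicative according to `a`,
the term `t` has a useful redex of kind `k` and position `C`, whose reduction yields `t'`. -/
inductive UsefulAt : Env → Bool → Term → Kind → Ctx → Term → Prop
  | var {e : Env} {a : Bool} {n : ℕ} {r : Term} : e.content n = some r →
      (HasBetaRedex (e.value n) ∨ ((∃ q, e.value n = .lam q) ∧ a = true)) →
      UsefulAt e a (.var n) .ls .hole r
  | beta {e : Env} {a : Bool} {L : Ctx} (s u : Term) : L.IsSubst →
      UsefulAt e a (.app (L.plug (.lam s)) u) .dB .hole (L.plug (.sub s (u.shift L.depth)))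
  | lam {e : Env} {a : Bool} {t t' : Term} {k : Kind} {C : Ctx} :
      UsefulAt e.lam false t k C t' → UsefulAt e a (.lam t) k (.lam C) (.lam t')
  | appL {e : Env} {a : Bool} {t t' : Term} {k : Kind} {C : Ctx} (u : Term) :
      UsefulAt e true t k C t' → UsefulAt e a (.app t u) k (.appL C u) (.app t' u)
  | appR {e : Env} {a : Bool} {u u' : Term} {k : Kind} {C : Ctx} (t : Term) :
      UsefulAt e false u k C u' → UsefulAt e a (.app t u) k (.appR t C) (.app t u')
  | sub {e : Env} {a : Bool} {t t' : Term} {k : Kind} {C : Ctx} (u : Term) :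
      UsefulAt (e.sub u) a t k C t' → UsefulAt e a (.sub t u) k (.sub C u) (.sub t' u)

theorem UsefulAt.plug (C : Ctx) : ∀ {e : Env} {a : Bool} {t t' : Term} {k : Kind},
    UsefulAt (e.ctx C) (C.flag a) t k .hole t' → UsefulAt e a (C.plug t) k C (C.plug t') := by
  induction C with
  | hole => exact fun h => h
  | lam C ih => exact fun h => .lam (ih h)
  | appL C u ih => exact fun h => .appL u (ih h)
  | appR u C ih => exact fun h => .appR u (ih h)
  | sub C u ih => exact fun h => .sub u (ih h)

theorem UsefulAt.exists_plug {e : Env} {a : Bool} {t t' : Term} {k : Kind} {C : Ctx}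
    (h : UsefulAt e a t k C t') :
    ∃ r r', t = C.plug r ∧ t' = C.plug r' ∧ UsefulAt (e.ctx C) (C.flag a) r k .hole r' := by
  induction h with
  | var h h' => exact ⟨_, _, rfl, rfl, .var h h'⟩
  | beta s u h => exact ⟨_, _, rfl, rfl, .beta s u h⟩
  | lam _ ih => obtain ⟨r, r', rfl, rfl, h⟩ := ih; exact ⟨r, r', rfl, rfl, h⟩
  | appL u _ ih => obtain ⟨r, r', rfl, rfl, h⟩ := ih; exact ⟨r, r', rfl, rfl, h⟩
  | appR u _ ih => obtain ⟨r, r', rfl, rfl, h⟩ := ih; exact ⟨r, r', rfl, rfl, h⟩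
  | sub u _ ih => obtain ⟨r, r', rfl, rfl, h⟩ := ih; exact ⟨r, r', rfl, rfl, h⟩

theorem IsUseful.usefulAt {s : Step} (h : IsUseful s) :
    UsefulAt Env.empty false s.src s.kind s.pos s.tgt := by
  cases h with
  | dB h hk =>
    cases h with
    | dB C L s u hL => exact UsefulAt.plug C (.beta s u hL)
    | ls => cases hk
  | ls r h hk hr hu =>
    cases h with
    | dB => cases hk
    | ls D C u =>
      have hr := Ctx.plug_injective _ hr
      subst hr
      have hc := Env.ctx_content_sub D C u Env.empty
      refine UsefulAt.plug _ (.var hc ?_)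
      -- By compatibility the value of the variable is the unfolding of its content, which is the
      -- relative unfolding in the usefulness condition.
      rw [(Env.compat_empty.ctx _).some _ _ hc, ← relUnfold_eq, Ctx.flag_eq_true]
      simpa using hu

theorem UsefulAt.isUseful {t t' : Term} {k : Kind} {C : Ctx}
    (hu : UsefulAt Env.empty false t k C t') : IsUseful ⟨k, C, t, t'⟩ := by
  obtain ⟨r, r', rfl, rfl, h⟩ := hu.exists_plug
  clear hu
  cases h with
  | beta s u hL => exact .dB (.dB C _ s u hL) rfl
  | @var _ _ n _ hc hu =>
    rw [(Env.compat_empty.ctx _).some _ _ hc, ← relUnfold_eq, Ctx.flag_eq_true] at hu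
    rcases Env.exists_sub_of_ctx_content C hc with ⟨D, C, u, rfl, rfl⟩ | ⟨m, -, hm⟩
    · rw [Env.ctx_content_sub, Option.some.injEq] at hc
      subst hc
      exact .ls _ (.ls D C u) rfl rfl (by simpa using hu)
    · simp [Env.empty] at hm

/-! ## Leftmost-outermost useful steps, structurally -/

/-- `LOUAt e a t k C t'`: the leftmost-outermost useful redex of `t`, in a context with
environment `e` and applicative according to `a`, has kind `k` and position `C`, and its
reduction yields `t'`. -/
inductive LOUAt : Env → Bool → Term → Kind → Ctx → Term → Prop
  | var {e : Env} {a : Bool} {n : ℕ} {r : Term} : e.content n = some r →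
      (HasBetaRedex (e.value n) ∨ ((∃ q, e.value n = .lam q) ∧ a = true)) →
      LOUAt e a (.var n) .ls .hole r
  | beta {e : Env} {a : Bool} {L : Ctx} (s u : Term) : L.IsSubst →
      LOUAt e a (.app (L.plug (.lam s)) u) .dB .hole (L.plug (.sub s (u.shift L.depth)))
  | lam {e : Env} {t t' : Term} {k : Kind} {C : Ctx} :
      LOUAt e.lam false t k C t' → LOUAt e false (.lam t) k (.lam C) (.lam t')
  | appL {e : Env} {a : Bool} {t t' : Term} {k : Kind} {C : Ctx} (u : Term) :
      ¬ t.IsAnswer → LOUAt e true t k C t' → LOUAt e a (.app t u) k (.appL C u) (.app t' u)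
  | appR {e : Env} {a : Bool} {t u u' : Term} {k : Kind} {C : Ctx} : ¬ t.IsAnswer →
      (∀ k D t', ¬ UsefulAt e true t k D t') → LOUAt e false u k C u' →
      LOUAt e a (.app t u) k (.appR t C) (.app t u')
  | sub {e : Env} {a : Bool} {t t' : Term} {k : Kind} {C : Ctx} (u : Term) :
      LOUAt (e.sub u) a t k C t' → LOUAt e a (.sub t u) k (.sub C u) (.sub t' u)

/-- Minimality is inherited by the subterm containing the redex. The hypothesis `ha` accounts for
the surroundings: an answer in applicative position would be the function part of a `dB`-redex
further out. -/
theorem UsefulAt.louAt_of_minimal {e : Env} {a : Bool} {t t' : Term} {k : Kind} {C : Ctx}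
    (h : UsefulAt e a t k C t') (ha : a = true → ¬ t.IsAnswer)
    (hmin : ∀ k' D t'', UsefulAt e a t k' D t'' → D ≠ C → LOOrder C D) :
    LOUAt e a t k C t' := by
  induction h with
  | var h h' => exact .var h h'
  | beta s u h => exact .beta s u h
  | @lam e a t t' k C _ ih =>
    cases a with
    | true => exact (ha rfl ⟨.hole, t, trivial, rfl⟩).elim
    | false =>
      exact .lam (ih (by simp) fun k' D t'' h hne =>
        (hmin _ _ _ (.lam h) (by simpa using hne)).of_lam)
  | @appL e a t t' k C u _ ih =>
    -- Otherwise the application itself is a `dB`-redex, at position `hole`, which no position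
    -- precedes.
    have hans : ¬ t.IsAnswer := by
      rintro ⟨L, s, hL, rfl⟩
      exact (hmin _ _ _ (.beta s u hL) (by simp)).ne_hole rfl
    exact .appL u hans (ih (fun _ => hans) fun k' D t'' h hne =>
      (hmin _ _ _ (.appL u h) (by simpa using hne)).of_appL)
  | @appR e a u u' k C t _ ih =>
    have hans : ¬ t.IsAnswer := by
      rintro ⟨L, s, hL, rfl⟩
      exact (hmin _ _ _ (.beta s u hL) (by simp)).ne_hole rfl
    exact .appR hans (fun k' D t' h => not_LOOrder_appR_appL (hmin _ _ _ (.appL u h) (by simp)))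
      (ih (by simp) fun k' D t'' h hne =>
        (hmin _ _ _ (.appR t h) (by simpa using hne)).of_appR)
  | @sub e a t t' k C u _ ih =>
    refine .sub u (ih ?_ fun k' D t'' h hne =>
      (hmin _ _ _ (.sub u h) (by simpa using hne)).of_sub)
    rintro h ⟨L, s, hL, rfl⟩
    exact ha h ⟨.sub L u, s, hL, rfl⟩

theorem IsLOU.louAt {s : Step} (h : IsLOU s) :
    LOUAt Env.empty false s.src s.kind s.pos s.tgt :=
  h.1.usefulAt.louAt_of_minimal (by simp) fun k' D t'' h' hne =>
    h.2 ⟨k', D, s.src, t''⟩ h'.isUseful rfl hne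

theorem LOUAt.usefulAt {e : Env} {a : Bool} {t t' : Term} {k : Kind} {C : Ctx}
    (h : LOUAt e a t k C t') : UsefulAt e a t k C t' := by
  induction h with
  | var h h' => exact .var h h'
  | beta s u h => exact .beta s u h
  | lam _ ih => exact .lam ih
  | appL u _ _ ih => exact .appL u ih
  | appR _ _ _ ih => exact .appR _ ih
  | sub u _ ih => exact .sub u ih

end LSC

namespace LSC

/-! ## Unfolding in an environment -/

/-- The unfolding of a term in an environment. -/
def Env.unfold (e : Env) (t : Term) : Term := t.unfold.subst e.value

theorem Env.unfold_lam (e : Env) (t : Term) : e.unfold (.lam t) = .lam (e.lam.unfold t) := rfl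

theorem Env.unfold_app (e : Env) (t u : Term) :
    e.unfold (.app t u) = .app (e.unfold t) (e.unfold u) := rfl

theorem Env.unfold_sub (e : Env) (t u : Term) : e.unfold (.sub t u) = (e.sub u).unfold t :=
  Term.unfold_sub_subst t u e

theorem Env.unfold_plug (L : Ctx) (hL : L.IsSubst) : ∀ (e : Env) (t : Term),
    e.unfold (L.plug t) = (e.ctx L).unfold t := by
  induction L with
  | hole => intros; rfl
  | sub L u ih => intro e t; rw [Ctx.plug, Env.unfold_sub, ih hL]; rfl
  | lam | appL | appR => exact hL.elim

theorem Env.unfold_ctx_shift (L : Ctx) (hL : L.IsSubst) : ∀ (e : Env) (t : Term),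
    (e.ctx L).unfold (t.shift L.depth) = e.unfold t := by
  induction L with
  | hole =>
    intro e t
    simp only [Env.unfold, Ctx.depth, Term.shift, Term.unfold_rename, Term.subst_rename, Env.ctx]
    congr 1
  | sub L u ih =>
    intro e t
    rw [Ctx.depth, Nat.add_comm, ← Term.shift_shift, Env.ctx, ih hL]
    simp only [Env.unfold, Term.shift, Term.unfold_rename, Term.subst_rename, Env.sub]
    congr 1
  | lam | appL | appR => exact hL.elim

theorem Env.unfold_isAnswer {e : Env} {t : Term} (h : t.IsAnswer) : ∃ s, e.unfold t = .lam s := by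
  obtain ⟨L, s, hL, rfl⟩ := h
  exact ⟨_, Env.unfold_plug L hL e _⟩

/-- A term without useful redexes unfolds to a beta-normal term. -/
theorem Env.Compat.normal_of_no_useful {t : Term} : ∀ {e : Env} {a : Bool}, e.Compat →
    (∀ k C t', ¬ UsefulAt e a t k C t') →
    ¬ HasBetaRedex (e.unfold t) ∧
      (a = true → ¬ t.IsAnswer → ¬ ∃ s, e.unfold t = .lam s) := by
  induction t with
  | var n =>
    intro e a he h
    change ¬ HasBetaRedex (e.value n) ∧ (a = true → _ → ¬ ∃ s, e.value n = .lam s)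
    cases hc : e.content n with
    | none =>
      obtain ⟨m, hm⟩ := he.none n hc
      rw [hm]
      exact ⟨not_hasBetaRedex_var m, by simp⟩
    | some r =>
      exact ⟨fun h' => h _ _ _ (.var hc (.inl h')),
        fun ha _ h' => h _ _ _ (.var hc (.inr ⟨h', ha⟩))⟩
  | lam t ih =>
    intro e a he h
    rw [Env.unfold_lam, hasBetaRedex_lam]
    exact ⟨(ih he.lam fun k C t' h' => h _ _ _ (.lam h')).1,
      fun _ hans => (hans ⟨.hole, t, trivial, rfl⟩).elim⟩
  | app t u iht ihu =>
    intro e a he h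
    have hans : ¬ t.IsAnswer := by
      rintro ⟨L, s, hL, rfl⟩
      exact h _ _ _ (.beta s u hL)
    obtain ⟨h₁, h₂⟩ := iht he fun k C t' h' => h _ _ _ (.appL u h')
    obtain ⟨h₃, -⟩ := ihu he fun k C t' h' => h _ _ _ (.appR t h')
    rw [Env.unfold_app, hasBetaRedex_app]
    -- A redex at the root would need the function part to unfold to an abstraction; `h₂` rules this
    -- out because the function part is in applicative position and not an answer.
    exact ⟨by simpa [h₁, h₃] using h₂ rfl hans, by simp⟩
  | sub t u iht ihu =>
    intro e a he h
    obtain ⟨h₁, h₂⟩ := iht (he.sub u) fun k C t' h' => h _ _ _ (.sub u h')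
    rw [Env.unfold_sub]
    refine ⟨h₁, fun ha hans => h₂ ha ?_⟩
    rintro ⟨L, s, hL, rfl⟩
    exact hans ⟨.sub L u, s, hL, rfl⟩

/-- A converse to `Env.Compat.normal_of_no_useful`: together they let the unfolding testify to the
presence of useful redexes. -/
theorem UsefulAt.hasBetaRedex_or {e : Env} {a : Bool} {t t' : Term} {k : Kind} {C : Ctx}
    (h : UsefulAt e a t k C t') :
    HasBetaRedex (e.unfold t) ∨ ((∃ s, e.unfold t = .lam s) ∧ a = true) := by
  induction h with
  | var _ h => exact h
  | @beta e a L s u h =>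
    rw [Env.unfold_app, hasBetaRedex_app]
    exact .inl (.inl (Env.unfold_isAnswer ⟨L, s, h, rfl⟩))
  | lam _ ih => rw [Env.unfold_lam, hasBetaRedex_lam]; exact .inl (by simpa using ih)
  | appL u _ ih => rw [Env.unfold_app, hasBetaRedex_app]; tauto
  | appR u _ ih => rw [Env.unfold_app, hasBetaRedex_app]; simp at ih; tauto
  | sub u _ ih => rwa [Env.unfold_sub]

theorem UsefulAt.unfold_eq {e : Env} {a : Bool} {t t' : Term} {k : Kind} {C : Ctx}
    (h : UsefulAt e a t k C t') (hk : k = .ls) (he : e.Compat) : e.unfold t' = e.unfold t := by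
  induction h with
  | var h _ => exact (he.some _ _ h).symm
  | beta => cases hk
  | lam _ ih => rw [Env.unfold_lam, ih hk he.lam, Env.unfold_lam]
  | appL u _ ih => rw [Env.unfold_app, ih hk he, Env.unfold_app]
  | appR u _ ih => rw [Env.unfold_app, ih hk he, Env.unfold_app]
  | sub u _ ih => rw [Env.unfold_sub, ih hk (he.sub u), Env.unfold_sub]

/-- Below its outer explicit substitutions such a term is an application: a variable has no
`dB`-redex, and an abstraction would make it an answer. -/
theorem UsefulAt.not_lam_of_dB {e : Env} {a : Bool} {t t' : Term} {k : Kind} {C : Ctx}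
    (h : UsefulAt e a t k C t') (hk : k = .dB) (hans : ¬ t.IsAnswer) :
    ¬ ∃ s, e.unfold t = .lam s := by
  induction h with
  | var => cases hk
  | beta | appL | appR => simp [Env.unfold_app]
  | lam => exact (hans ⟨.hole, _, trivial, rfl⟩).elim
  | sub u _ ih =>
    rw [Env.unfold_sub]
    refine ih hk ?_
    rintro ⟨L, s, hL, rfl⟩
    exact hans ⟨.sub L u, s, hL, rfl⟩

/-- A leftmost-outermost useful `dB`-step unfolds to a leftmost-outermost beta-step. -/
theorem LOUAt.structLOBeta {e : Env} {a : Bool} {t t' : Term} {k : Kind} {C : Ctx}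
    (h : LOUAt e a t k C t') (hk : k = .dB) (he : e.Compat) :
    StructLOBeta (e.unfold t) (e.unfold t') := by
  induction h with
  | var => cases hk
  | @beta e a L s u hL =>
    rw [Env.unfold_app, Env.unfold_plug L hL, Env.unfold_plug L hL, Env.unfold_lam]
    -- The new explicit substitution unfolds to the meta-level one of the β-step, and the weakened
    -- argument unfolds as if it were outside `L`.
    have key : (e.ctx L).unfold (.sub s (u.shift L.depth)) =
        ((e.ctx L).lam.unfold s).substAt 0 (e.unfold u) := by
      simp only [Term.substAt, Function.iterate_zero, id, Env.unfold, Env.lam,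
        Term.subst_up_subst_single, Term.unfold_sub_subst, Env.sub]
      congr 2
      exact Env.unfold_ctx_shift L hL e u
    rw [key]
    exact .beta _ _
  | lam _ ih => exact .lam (ih hk he.lam)
  | appL u hans h ih => exact .appL _ (h.usefulAt.not_lam_of_dB hk hans) (ih hk he)
  | appR hans hno _ ih =>
    obtain ⟨h₁, h₂⟩ := he.normal_of_no_useful hno
    exact .appR (h₂ rfl hans) h₁ (ih hk he)
  | sub u _ ih =>
    rw [Env.unfold_sub, Env.unfold_sub]
    exact ih hk (he.sub u)

/-- Two consecutive leftmost-outermost useful substitution steps are outside-in. -/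
theorem LOUAt.outsideIn {e : Env} {a : Bool} {t t' : Term} {k : Kind} {C : Ctx}
    (h : LOUAt e a t k C t') : ∀ {k' : Kind} {C' : Ctx} {t'' : Term}, k = .ls → k' = .ls →
    e.Compat → LOUAt e a t' k' C' t'' →
    ∃ (D : Ctx) (x y : ℕ) (u : Term), C' = C.comp D ∧ t = C.plug (.var x) ∧
      t' = C.plug (D.plug (.var y)) ∧ t'' = C.plug (D.plug u) := by
  induction h with
  | @var e a n r _ _ =>
    -- The first step replaced the whole term by its copy, so the second one is necessarily inside
    -- the copy.
    rintro k' C' t'' - rfl he h'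
    obtain ⟨r, r', rfl, rfl, h⟩ := h'.usefulAt.exists_plug
    clear h'
    cases h with
    | var => exact ⟨C', n, _, r', rfl, rfl, rfl, rfl⟩
  | beta => intro _ _ _ h; cases h
  | lam _ ih =>
    intro k' C' t'' hk hk' he h'
    cases h' with
    | lam h' =>
      obtain ⟨D, x, y, u, rfl, rfl, rfl, rfl⟩ := ih hk hk' he.lam h'
      exact ⟨D, x, y, u, rfl, rfl, rfl, rfl⟩
  | @appL e a t t' k C v hans h ih =>
    intro k' C' t'' hk hk' he h'
    cases h' with
    | beta => cases hk'
    | appL _ _ h' =>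
      obtain ⟨D, x, y, u, rfl, rfl, rfl, rfl⟩ := ih hk hk' he h'
      exact ⟨D, x, y, u, rfl, rfl, rfl, rfl⟩
    -- Passing to the argument would mean that the function part has no useful redex left, so its
    -- unfolding is normal and not an abstraction. But it is the unfolding from before the step,
    -- when a useful redex was present.
    | appR hans' hno _ =>
      obtain ⟨h₁, h₂⟩ := he.normal_of_no_useful hno
      rw [h.usefulAt.unfold_eq hk he] at h₁ h₂
      rcases h.usefulAt.hasBetaRedex_or with h | ⟨h, -⟩
      · exact (h₁ h).elim
      · exact (h₂ rfl hans' h).elim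
  | appR hans hno _ ih =>
    intro k' C' t'' hk hk' he h'
    cases h' with
    | beta => cases hk'
    | appL _ _ h' => exact (hno _ _ _ h'.usefulAt).elim
    | appR _ _ h' =>
      obtain ⟨D, x, y, u, rfl, rfl, rfl, rfl⟩ := ih hk hk' he h'
      exact ⟨D, x, y, u, rfl, rfl, rfl, rfl⟩
  | sub v _ ih =>
    intro k' C' t'' hk hk' he h'
    cases h' with
    | sub _ h' =>
      obtain ⟨D, x, y, u, rfl, rfl, rfl, rfl⟩ := ih hk hk' (he.sub v) h'
      exact ⟨D, x, y, u, rfl, rfl, rfl, rfl⟩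

theorem IsDerivation.isOutsideIn {ρ : List Step} : ∀ {t u : Term},
    IsDerivation IsLOU t ρ u → IsOutsideIn ρ := by
  unfold IsOutsideIn
  induction ρ with
  | nil => intros; exact .nil
  | cons s ρ ih =>
    rintro t u ⟨rfl, hs, hρ⟩
    cases ρ with
    | nil => exact .singleton _
    | cons s' ρ =>
      refine List.IsChain.cons_cons (fun hk hk' => ?_) (ih hρ)
      obtain ⟨k, C, t, t'⟩ := s
      obtain ⟨k', C', t₁, t''⟩ := s'
      obtain ⟨rfl, hs', -⟩ := hρ
      obtain ⟨D, x, y, u, h₁, h₂, h₃, h₄⟩ :=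
        hs.louAt.outsideIn hk hk' Env.compat_empty hs'.louAt
      simp only at hk hk' h₁ h₂ h₃ h₄
      subst hk hk' h₁ h₂ h₄
      rw [h₃]
      exact ⟨C, D, x, y, u, rfl, rfl⟩

/-! ## Unfolding of leftmost-outermost useful derivations -/

theorem Env.empty_unfold (t : Term) : Env.empty.unfold t = t.unfold := t.unfold.subst_var

theorem IsDerivation.loBetaSteps {ρ : List Step} : ∀ {t u : Term},
    IsDerivation IsLOU t ρ u → LOBetaSteps (dBCount ρ) t.unfold u.unfold := by
  induction ρ with
  | nil => rintro t u rfl; exact rfl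
  | cons s ρ ih =>
    rintro t u ⟨rfl, hs, hρ⟩
    have h := hs.louAt
    obtain ⟨k, C, t, t'⟩ := s
    cases k with
    | dB =>
      have := (h.structLOBeta rfl Env.compat_empty).loBetaStep
      rw [Env.empty_unfold, Env.empty_unfold] at this
      exact ⟨_, this, ih hρ⟩
    | ls =>
      have := h.usefulAt.unfold_eq rfl Env.compat_empty
      rw [Env.empty_unfold, Env.empty_unfold] at this
      have ih := ih hρ
      rw [this] at ih
      exact ih

/-! ## The subterm property of leftmost-outermost useful derivations -/

/-- All arguments and all contents of explicit substitutions that `t` has in shallow position,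
without entering arguments, satisfy `p`. -/
def Term.Fresh (p : Term → Prop) : Term → Prop
  | .var _ => True
  | .lam t => t.Fresh p
  | .app t u => t.Fresh p ∧ p u
  | .sub t u => t.Fresh p ∧ p u

/-- The invariant of leftmost-outermost useful reduction: the part of `t` that reduction may still
visit is made of terms satisfying `p`. -/
def Inv (p : Term → Prop) : Env → Bool → Term → Prop
  | _, _, .var _ => True
  | e, a, .lam t => if a then t.Fresh p else Inv p e.lam false t
  | e, _, .app t u => (Inv p e true t ∧ p u) ∨
      (¬ t.IsAnswer ∧ (∀ k D t', ¬ UsefulAt e true t k D t') ∧ Inv p e false u)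
  | e, a, .sub t u => Inv p (e.sub u) a t ∧ p u

/-- Predicates that are closed under renaming and under immediate subterms. -/
structure Hereditary (p : Term → Prop) : Prop where
  rename : ∀ t ξ, p t → p (t.rename ξ)
  lam : ∀ t, p (.lam t) → p t
  app : ∀ t u, p (.app t u) → p t ∧ p u
  sub : ∀ t u, p (.sub t u) → p t ∧ p u

theorem Term.Fresh.inv {p : Term → Prop} {t : Term} : t.Fresh p → ∀ (e : Env) (a : Bool),
    Inv p e a t := by
  induction t with
  | var n => intros; trivial
  | lam t ih =>
    intro h e a
    cases a with
    | true => exact h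
    | false => exact ih h _ _
  | app t u iht ihu => exact fun h e a => .inl ⟨iht h.1 _ _, h.2⟩
  | sub t u iht ihu => exact fun h e a => ⟨iht h.1 _ _, h.2⟩

theorem Hereditary.fresh {p : Term → Prop} (hp : Hereditary p) {t : Term} : p t → t.Fresh p := by
  induction t with
  | var n => intro; trivial
  | lam t ih => exact fun h => ih (hp.lam t h)
  | app t u iht ihu => exact fun h => ⟨iht (hp.app t u h).1, (hp.app t u h).2⟩
  | sub t u iht ihu => exact fun h => ⟨iht (hp.sub t u h).1, (hp.sub t u h).2⟩

/-- In applicative position `Inv` keeps the body of an abstraction fresh, as reduction does not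
enter it before the `dB`-step. The released body therefore satisfies the invariant in any
environment. -/
theorem Hereditary.inv_beta {p : Term → Prop} (hp : Hereditary p) {L : Ctx} (hL : L.IsSubst)
    {s : Term} : ∀ {e : Env} {u : Term} (a : Bool), Inv p e true (L.plug (.lam s)) → p u →
    Inv p e a (L.plug (.sub s (u.shift L.depth))) := by
  induction L with
  | hole => exact fun a h hu => ⟨Term.Fresh.inv h _ _, hp.rename _ _ hu⟩
  | sub L v ih =>
    intro e u a h hu
    refine ⟨?_, h.2⟩
    rw [Ctx.depth, Nat.add_comm, ← Term.shift_shift]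
    exact ih hL a h.1 (hp.rename _ _ hu)
  | lam | appL | appR => exact hL.elim

theorem Hereditary.content_lam {p : Term → Prop} (hp : Hereditary p) {e : Env}
    (he : ∀ n r, e.content n = some r → p r) : ∀ n r, e.lam.content n = some r → p r := by
  rintro (_ | n) r h
  · simp [Env.lam, consContent] at h
  · simp only [Env.lam, consContent, Option.map_eq_some_iff] at h
    obtain ⟨r, h, rfl⟩ := h
    exact hp.rename _ _ (he n r h)

theorem Hereditary.content_sub {p : Term → Prop} (hp : Hereditary p) {e : Env} {u : Term}
    (he : ∀ n r, e.content n = some r → p r) (hu : p u) :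
    ∀ n r, (e.sub u).content n = some r → p r := by
  rintro (_ | n) r h
  · simp only [Env.sub, consContent, Option.map_some, Option.some.injEq] at h
    subst h
    exact hp.rename _ _ hu
  · simp only [Env.sub, consContent, Option.map_eq_some_iff] at h
    obtain ⟨r, h, rfl⟩ := h
    exact hp.rename _ _ (he n r h)

/-- Contents in the environment satisfy `p`, so a copy is fresh. Once reduction enters an argument,
the function part has no useful redex and stays unchanged, so nothing more is required of it. -/
theorem LOUAt.inv {p : Term → Prop} (hp : Hereditary p) {e : Env} {a : Bool} {t t' : Term}
    {k : Kind} {C : Ctx} (h : LOUAt e a t k C t') (he : ∀ n r, e.content n = some r → p r)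
    (ht : Inv p e a t) :
    Inv p e a t' ∧ (k = .ls → ∃ r, t' = C.plug r ∧ p r) := by
  induction h with
  | var h _ =>
    exact ⟨(hp.fresh (he _ _ h)).inv _ _, fun _ => ⟨_, rfl, he _ _ h⟩⟩
  | @beta e a L s u hL =>
    rcases ht with ⟨ht, hu⟩ | ⟨hans, -⟩
    · exact ⟨hp.inv_beta hL a ht hu, by simp⟩
    · exact (hans ⟨L, s, hL, rfl⟩).elim
  | lam _ ih =>
    obtain ⟨h₁, h₂⟩ := ih (hp.content_lam he) ht
    refine ⟨h₁, fun hk => ?_⟩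
    obtain ⟨r, rfl, hr⟩ := h₂ hk
    exact ⟨r, rfl, hr⟩
  | appL u hans h ih =>
    rcases ht with ⟨ht, hu⟩ | ⟨-, hno, -⟩
    · obtain ⟨h₁, h₂⟩ := ih he ht
      refine ⟨.inl ⟨h₁, hu⟩, fun hk => ?_⟩
      obtain ⟨r, rfl, hr⟩ := h₂ hk
      exact ⟨r, rfl, hr⟩
    · exact (hno _ _ _ h.usefulAt).elim
  | @appR e a t u u' k C hans hno _ ih =>
    have hu : Inv p e false u := by
      rcases ht with ⟨-, hu⟩ | ⟨-, -, hu⟩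
      · exact (hp.fresh hu).inv _ _
      · exact hu
    obtain ⟨h₁, h₂⟩ := ih he hu
    refine ⟨.inr ⟨hans, hno, h₁⟩, fun hk => ?_⟩
    obtain ⟨r, rfl, hr⟩ := h₂ hk
    exact ⟨r, rfl, hr⟩
  | sub u _ ih =>
    obtain ⟨h₁, h₂⟩ := ih (hp.content_sub he ht.2) ht.1
    refine ⟨⟨h₁, ht.2⟩, fun hk => ?_⟩
    obtain ⟨r, rfl, hr⟩ := h₂ hk
    exact ⟨r, rfl, hr⟩

/-! ### Subterms up to the names of variables -/

theorem Term.eraseVars_rename (t : Term) : ∀ ξ : ℕ → ℕ,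
    (t.rename ξ).eraseVars = t.eraseVars := by
  induction t <;> simp_all [Term.rename, Term.eraseVars]

theorem Subterm.trans {r s t : Term} (h : Subterm r s) (h' : Subterm s t) : Subterm r t := by
  induction h' with
  | refl => exact h
  | lam _ ih => exact .lam ih
  | appL _ _ ih => exact .appL _ ih
  | appR _ _ ih => exact .appR _ ih
  | subL _ _ ih => exact .subL _ ih
  | subR _ _ ih => exact .subR _ ih

theorem hereditary_subterm (t : Term) :
    Hereditary (fun u => Subterm u.eraseVars t.eraseVars) where
  rename u ξ h := by rwa [Term.eraseVars_rename]
  lam u h := (Subterm.lam (.refl _)).trans h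
  app u v h := ⟨(Subterm.appL _ (.refl _)).trans h, (Subterm.appR _ (.refl _)).trans h⟩
  sub u v h := ⟨(Subterm.subL _ (.refl _)).trans h, (Subterm.subR _ (.refl _)).trans h⟩

theorem IsDerivation.forall_inv {p : Term → Prop} (hp : Hereditary p) {ρ : List Step} :
    ∀ {t u : Term}, IsDerivation IsLOU t ρ u → Inv p Env.empty false t →
    ∀ s ∈ ρ, s.kind = .ls → ∀ r, s.tgt = s.pos.plug r → p r := by
  induction ρ with
  | nil => simp
  | cons s ρ ih =>
    rintro t u ⟨rfl, hs, hρ⟩ ht s' hs' hk r hr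
    obtain ⟨h₁, h₂⟩ := hs.louAt.inv hp (by simp [Env.empty]) ht
    rcases List.mem_cons.1 hs' with rfl | hs'
    · obtain ⟨r', hr', hp'⟩ := h₂ hk
      rwa [Ctx.plug_injective _ (hr.symm.trans hr')]
    · exact ih hρ h₁ s' hs' hk r hr

theorem IsDerivation.subtermProperty {ρ : List Step} {t u : Term}
    (h : IsDerivation IsLOU t ρ u) : SubtermProperty t ρ :=
  have hp := hereditary_subterm t
  h.forall_inv hp ((hp.fresh (.refl _)).inv _ _)

/-! ## Counting explicit substitutions -/

/-- The number of explicit substitutions of a term. -/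
def Term.esCount : Term → ℕ
  | .var _ => 0
  | .lam t => t.esCount
  | .app t u => t.esCount + u.esCount
  | .sub t u => t.esCount + u.esCount + 1

/-- The number of explicit substitutions in a context. -/
def Ctx.esCount : Ctx → ℕ
  | .hole => 0
  | .lam C => C.esCount
  | .appL C u => C.esCount + u.esCount
  | .appR u C => C.esCount + u.esCount
  | .sub C u => C.esCount + u.esCount + 1

/-- The number of explicit substitutions on the path to the hole of a context. -/
def Ctx.subDepth : Ctx → ℕ
  | .hole => 0
  | .lam C => C.subDepth
  | .appL C _ => C.subDepth
  | .appR _ C => C.subDepth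
  | .sub C _ => C.subDepth + 1

theorem Ctx.esCount_plug (C : Ctx) (t : Term) : (C.plug t).esCount = C.esCount + t.esCount := by
  induction C <;> simp_all [Ctx.plug, Term.esCount, Ctx.esCount] <;> omega

theorem Ctx.subDepth_le_esCount (C : Ctx) : C.subDepth ≤ C.esCount := by
  induction C <;> simp only [Ctx.subDepth, Ctx.esCount] <;> omega

theorem Ctx.subDepth_comp (C D : Ctx) : (C.comp D).subDepth = C.subDepth + D.subDepth := by
  induction C <;> simp_all [Ctx.comp, Ctx.subDepth]
  omega

theorem Term.esCount_rename (t : Term) : ∀ ξ : ℕ → ℕ, (t.rename ξ).esCount = t.esCount := by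
  induction t <;> simp_all [Term.rename, Term.esCount]

theorem Term.esCount_eraseVars (t : Term) : t.eraseVars.esCount = t.esCount := by
  induction t <;> simp_all [Term.eraseVars, Term.esCount]

theorem Subterm.esCount_le {u t : Term} (h : Subterm u t) : u.esCount ≤ t.esCount := by
  induction h with
  | refl => exact le_rfl
  | _ => simp only [Term.esCount]; omega

theorem Term.IsLambda.esCount_eq {t : Term} (h : t.IsLambda) : t.esCount = 0 := by
  induction t with
  | var n => rfl
  | lam t ih => exact ih h
  | app t u iht ihu => simp [Term.esCount, iht h.1, ihu h.2]
  | sub t u => exact h.elim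

theorem SubtermProperty.esCount_eq {t : Term} {ρ : List Step} (ht : t.IsLambda)
    (h : SubtermProperty t ρ) :
    ∀ s ∈ ρ, s.kind = .ls → ∀ r, s.tgt = s.pos.plug r → r.esCount = 0 := by
  intro s hs hk r hr
  have := (h s hs hk r hr).esCount_le
  rw [Term.esCount_eraseVars, Term.esCount_eraseVars, ht.esCount_eq] at this
  omega

/-- A `dB`-step creates exactly one explicit substitution and duplicates nothing; an `ls`-step adds
only those of the copied term, here none. -/
theorem IsDerivation.esCount_eq {ρ : List Step} : ∀ {t u : Term}, IsDerivation IsStep t ρ u →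
    (∀ s ∈ ρ, s.kind = .ls → ∀ r, s.tgt = s.pos.plug r → r.esCount = 0) →
    u.esCount = t.esCount + dBCount ρ := by
  induction ρ with
  | nil => rintro t u rfl -; rfl
  | cons s ρ ih =>
    rintro t u ⟨rfl, hs, hρ⟩ h
    rw [ih hρ fun s' hs' => h s' (List.mem_cons_of_mem _ hs')]
    have h := h s List.mem_cons_self
    cases hs with
    | dB C L s u hL =>
      simp only [dBCount, Ctx.esCount_plug, Term.esCount, Term.shift, Term.esCount_rename]
      omega
    | ls D C u =>
      simp only [dBCount, Ctx.esCount_plug, Term.esCount, h rfl _ rfl]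

/-! ### Binders along the path to a position -/

/-- Variables of a renamed term that are not bound in it are in the range of the renaming. -/
theorem Ctx.lt_or_of_rename_eq_plug (C : Ctx) : ∀ {t : Term} {ξ : ℕ → ℕ} {y m : ℕ},
    (∀ n, m ≤ ξ n) → t.rename ξ = C.plug (.var y) → y < C.depth ∨ C.depth + m ≤ y := by
  -- Under `d` binders the lifted renaming avoids the window from `d` to `d + m`; this form is
  -- stable under one more binder.
  suffices key : ∀ (C : Ctx) {t : Term} {ξ : ℕ → ℕ} {y m d : ℕ},
      (∀ n, ξ n < d ∨ d + m ≤ ξ n) → t.rename ξ = C.plug (.var y) →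
      y < C.depth + d ∨ C.depth + d + m ≤ y by
    intro t ξ y m h ht
    simpa using key C (d := 0) (by simpa using h) ht
  have up_le : ∀ {ξ : ℕ → ℕ} {m d : ℕ}, (∀ n, ξ n < d ∨ d + m ≤ ξ n) →
      ∀ n, upRen ξ n < d + 1 ∨ d + 1 + m ≤ upRen ξ n := by
    rintro ξ m d h (_ | n)
    · exact .inl (Nat.succ_pos d)
    · have := h n
      simp only [upRen]
      omega
  intro C
  induction C with
  | hole =>
    intro t ξ y m d h ht
    cases t <;> simp only [Term.rename, Ctx.plug, Term.var.injEq, reduceCtorEq] at ht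
    subst ht
    simpa [Ctx.depth] using h _
  | lam C ih =>
    intro t ξ y m d h ht
    cases t <;> simp only [Term.rename, Ctx.plug, Term.lam.injEq, reduceCtorEq] at ht
    have := ih (up_le h) ht
    simp only [Ctx.depth]
    omega
  | appL C u ih =>
    intro t ξ y m d h ht
    cases t <;> simp only [Term.rename, Ctx.plug, Term.app.injEq, reduceCtorEq] at ht
    exact ih h ht.1
  | appR u C ih =>
    intro t ξ y m d h ht
    cases t <;> simp only [Term.rename, Ctx.plug, Term.app.injEq, reduceCtorEq] at ht
    exact ih h ht.2
  | sub C u ih =>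
    intro t ξ y m d h ht
    cases t <;> simp only [Term.rename, Ctx.plug, Term.sub.injEq, reduceCtorEq] at ht
    have := ih (up_le h) ht.1
    simp only [Ctx.depth]
    omega

/-- Of two explicit substitutions on the same path, the outer one has fewer explicit
substitutions above it. -/
theorem Ctx.subDepth_lt_of_comp_eq (D : Ctx) : ∀ {D' C C' : Ctx} {u u' : Term},
    D'.comp (.sub C' u') = D.comp (.sub C u) → D'.depth < D.depth →
    D'.subDepth < D.subDepth := by
  induction D with
  | hole => intro D' C C' u u' _ h; simp [Ctx.depth] at h
  | lam D ih =>
    intro D' C C' u u' h hlt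
    cases D' <;> simp only [Ctx.comp, Ctx.lam.injEq, reduceCtorEq] at h
    have := ih h (by simpa [Ctx.depth] using hlt)
    exact this
  | appL D v ih =>
    intro D' C C' u u' h hlt
    cases D' <;> simp only [Ctx.comp, Ctx.appL.injEq, reduceCtorEq] at h
    have := ih h.1 hlt
    exact this
  | appR v D ih =>
    intro D' C C' u u' h hlt
    cases D' <;> simp only [Ctx.comp, Ctx.appR.injEq, reduceCtorEq] at h
    have := ih h.2 hlt
    exact this
  | sub D v ih =>
    intro D' C C' u u' h hlt
    cases D' <;> simp only [Ctx.comp, Ctx.sub.injEq, reduceCtorEq] at h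
    · simp [Ctx.subDepth]
    · have := ih h.1 (by simpa [Ctx.depth] using hlt)
      simpa [Ctx.subDepth] using this

/-- An explicit substitution that is not above the end of `D` lies on the path `F`. With `F` inside
a substitution-free copy this is a contradiction. -/
theorem Ctx.subDepth_pos_of_comp_eq (D : Ctx) : ∀ {D' C' F : Ctx} {u' : Term},
    D'.comp (.sub C' u') = D.comp F → D.depth ≤ D'.depth → 0 < F.subDepth := by
  induction D with
  | hole =>
    rintro D' C' F u' rfl -
    simp only [Ctx.subDepth_comp, Ctx.subDepth]
    omega
  | lam D ih =>
    intro D' C' F u' h hle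
    cases D' <;> simp only [Ctx.comp, Ctx.lam.injEq, reduceCtorEq] at h
    exact ih h (by simpa [Ctx.depth] using hle)
  | appL D v ih =>
    intro D' C' F u' h hle
    cases D' <;> simp only [Ctx.comp, Ctx.appL.injEq, reduceCtorEq] at h
    exact ih h.1 hle
  | appR v D ih =>
    intro D' C' F u' h hle
    cases D' <;> simp only [Ctx.comp, Ctx.appR.injEq, reduceCtorEq] at h
    exact ih h.2 hle
  | sub D v ih =>
    intro D' C' F u' h hle
    cases D' <;> simp only [Ctx.comp, Ctx.sub.injEq, reduceCtorEq] at h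
    · simp [Ctx.depth] at hle
    · exact ih h.1 (by simpa [Ctx.depth] using hle)

end LSC

namespace LSC

/-! ## Length of outside-in sequences -/

theorem IsStep.exists_ls {s : Step} (h : IsStep s) (hk : s.kind = .ls) :
    ∃ (D C : Ctx) (w : Term), s = ⟨.ls, D.comp (.sub C w), (D.comp (.sub C w)).plug (.var C.depth),
      (D.comp (.sub C w)).plug (w.shift (C.depth + 1))⟩ := by
  cases h with
  | dB => cases hk
  | ls D C w => exact ⟨D, C, w, rfl⟩

/-- Along an outside-in sequence, the explicit substitutions involved move strictly outwards on
the path to the first position. -/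
theorem IsDerivation.length_le_subDepth {σ : List Step} : ∀ {t r : Term} {s : Step},
    IsDerivation IsStep t (s :: σ) r → AllLs (s :: σ) → IsOutsideIn (s :: σ) →
    (∀ s' ∈ s :: σ, s'.kind = .ls → ∀ r, s'.tgt = s'.pos.plug r → r.esCount = 0) →
    ∀ (D C : Ctx) (w : Term), s = ⟨.ls, D.comp (.sub C w),
      (D.comp (.sub C w)).plug (.var C.depth),
      (D.comp (.sub C w)).plug (w.shift (C.depth + 1))⟩ →
    (s :: σ).length ≤ D.subDepth + 1 := by
  induction σ with
  | nil => intros; simp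
  | cons s' σ ih =>
    rintro t r s ⟨-, -, hσ⟩ hls hoi hes D C w hs
    have hls' : AllLs (s' :: σ) := fun q hq => hls q (List.mem_cons_of_mem _ hq)
    obtain ⟨D', C', w', hs'⟩ := hσ.2.1.exists_ls (hls' s' List.mem_cons_self)
    have hlen := ih hσ hls' hoi.tail (fun q hq => hes q (List.mem_cons_of_mem _ hq)) D' C' w' hs'
    obtain ⟨E, F, x, y, v, h₁, h₂⟩ := (List.isChain_cons_cons.1 hoi).1
      (hls s List.mem_cons_self) (hls' s' List.mem_cons_self)
    have hz := hes s List.mem_cons_self (hls s List.mem_cons_self)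
    rw [hs] at h₁ hz
    rw [hs'] at h₂
    simp only [Step.mk.injEq, true_and] at h₁ h₂
    obtain ⟨rfl, -, hF⟩ := h₁
    obtain ⟨hpos, hy, -⟩ := h₂
    replace hF := Ctx.plug_injective _ hF
    have hz := hz _ rfl
    -- `F` is a path inside the copied term, so it crosses no explicit substitution.
    rw [hF, Ctx.esCount_plug] at hz
    have hF0 := F.subDepth_le_esCount
    rw [hpos, Ctx.plug_comp] at hy
    have hy := Ctx.plug_injective _ (Ctx.plug_injective _ hy)
    rw [Term.var.injEq] at hy
    subst hy
    have hdepth := congrArg Ctx.depth hpos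
    simp only [Ctx.depth_comp, Ctx.depth] at hdepth
    -- The copy was weakened by `C.depth + 1`, so its variable, of index `C'.depth`, cannot refer to
    -- the first substitution or to a binder of `C`. Its binder is in `F`, which is impossible, or
    -- strictly outside the first substitution.
    rcases F.lt_or_of_rename_eq_plug (m := C.depth + 1) (by simp) hF with hlt | hle
    · have := Ctx.subDepth_pos_of_comp_eq _ hpos (by
        simp only [Ctx.depth_comp, Ctx.depth]; omega)
      omega
    · rw [Ctx.comp_assoc] at hpos
      have := Ctx.subDepth_lt_of_comp_eq D hpos (by omega)
      simp only [List.length_cons] at hlen ⊢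
      omega

theorem IsDerivation.length_le_esCount {σ : List Step} {u r : Term}
    (h : IsDerivation IsStep u σ r) (hls : AllLs σ) (hoi : IsOutsideIn σ)
    (hes : ∀ s ∈ σ, s.kind = .ls → ∀ r, s.tgt = s.pos.plug r → r.esCount = 0) :
    σ.length ≤ u.esCount := by
  cases σ with
  | nil => simp
  | cons s σ =>
    obtain ⟨D, C, w, hs⟩ := h.2.1.exists_ls (hls s List.mem_cons_self)
    have hlen := h.length_le_subDepth hls hoi hes D C w hs
    obtain ⟨rfl, -, -⟩ := h
    rw [hs, Ctx.esCount_plug]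
    have := (D.comp (.sub C w)).subDepth_le_esCount
    simp only [Ctx.subDepth_comp, Ctx.subDepth, List.length_cons] at this hlen ⊢
    omega

/-! ### Local boundedness and the quadratic bound -/

theorem dBCount_append (ρ σ : List Step) : dBCount (ρ ++ σ) = dBCount ρ + dBCount σ := by
  induction ρ with
  | nil => simp [dBCount]
  | cons s ρ ih =>
    obtain ⟨k, C, t, t'⟩ := s
    cases k <;> simp only [List.cons_append, dBCount, ih]
    omega

theorem AllLs.dBCount_eq {σ : List Step} (h : AllLs σ) : dBCount σ = 0 := by
  induction σ with
  | nil => rfl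
  | cons s σ ih =>
    obtain ⟨k, C, t, t'⟩ := s
    obtain rfl : k = .ls := h _ List.mem_cons_self
    exact ih fun s hs => h s (List.mem_cons_of_mem _ hs)

theorem SubtermProperty.length_le_dBCount {t u r : Term} {ρ σ : List Step} (ht : t.IsLambda)
    (hρ : IsDerivation IsStep t ρ u) (hσ : IsDerivation IsStep u σ r) (hls : AllLs σ)
    (h : SubtermProperty t (ρ ++ σ)) (hoi : IsOutsideIn σ) :
    σ.length ≤ dBCount (ρ ++ σ) := by
  have hes := h.esCount_eq ht
  have h₁ := hρ.esCount_eq fun s hs => hes s (List.mem_append_left _ hs)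
  have h₂ := hσ.length_le_esCount hls hoi fun s hs => hes s (List.mem_append_right _ hs)
  rw [ht.esCount_eq] at h₁
  rw [dBCount_append]
  omega

theorem IsDerivation.mono {P Q : Step → Prop} (hPQ : ∀ s, P s → Q s) {ρ : List Step} :
    ∀ {t u : Term}, IsDerivation P t ρ u → IsDerivation Q t ρ u := by
  induction ρ with
  | nil => exact fun h => h
  | cons s ρ ih => exact fun h => ⟨h.1, hPQ _ h.2.1, ih h.2.2⟩

theorem isDerivation_append {P : Step → Prop} {ρ σ : List Step} : ∀ {t r : Term},
    IsDerivation P t (ρ ++ σ) r ↔ ∃ u, IsDerivation P t ρ u ∧ IsDerivation P u σ r := by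
  induction ρ with
  | nil => simp [IsDerivation]
  | cons s ρ ih => simp [IsDerivation, ih, and_assoc]

theorem IsLOU.isStep {s : Step} (h : IsLOU s) : IsStep s := by
  cases h.1 <;> assumption

theorem IsDerivation.length_le_dBCount {t u r : Term} {ρ σ : List Step} (ht : t.IsLambda)
    (hρ : IsDerivation IsLOU t ρ u) (hσ : IsDerivation IsLOU u σ r) (hls : AllLs σ) :
    σ.length ≤ dBCount ρ := by
  have := (isDerivation_append.2 ⟨u, hρ, hσ⟩).subtermProperty.length_le_dBCount ht
    (hρ.mono fun _ => IsLOU.isStep) (hσ.mono fun _ => IsLOU.isStep) hls hσ.isOutsideIn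
  rwa [dBCount_append, hls.dBCount_eq] at this

/-- The suffix `σ` is the current block of `ls`-steps. Peeling `ρ` from the right, an `ls`-step
joins the block and a `dB`-step closes it. -/
theorem IsDerivation.length_append_le {t : Term} (ht : t.IsLambda) (ρ : List Step) :
    ∀ {u : Term} {σ : List Step}, IsDerivation IsLOU t (ρ ++ σ) u → AllLs σ →
      ρ.length + σ.length ≤ dBCount ρ + dBCount ρ ^ 2 := by
  induction ρ using List.reverseRecOn with
  | nil =>
    intro u σ h hls
    have := IsDerivation.length_le_dBCount (ρ := []) ht rfl h hls
    simpa [dBCount] using this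
  | append_singleton ρ s ih =>
    intro u σ h hls
    have hcount := dBCount_append ρ [s]
    obtain ⟨v, h₁, h₂⟩ := isDerivation_append.1 h
    have hlen := IsDerivation.length_le_dBCount ht h₁ h₂ hls
    obtain ⟨k, C, r, r'⟩ := s
    cases k with
    | ls =>
      have := ih (σ := ⟨.ls, C, r, r'⟩ :: σ) (by simpa using h)
        (by simpa [AllLs] using hls)
      simp only [dBCount, Nat.add_zero] at hcount
      rw [hcount]
      simp only [List.length_append, List.length_cons, List.length_nil] at this ⊢
      omega
    | dB =>
      obtain ⟨w, h₃, -⟩ := isDerivation_append.1 h₁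
      have := ih (σ := []) (by simpa using h₃) (by simp [AllLs])
      simp only [dBCount] at hcount
      rw [hcount] at hlen ⊢
      simp only [List.length_append, List.length_cons, List.length_nil] at this ⊢
      -- With `n` the number of `dB`-steps before the last one, the prefix contributes at most `n +
      -- n ^ 2`, the `dB`-step `1` and the block `n + 1`; the sum is at most `(n + 1) + (n + 1) ^
      -- 2`.
      nlinarith

end LSC

theorem mainTheorem10 :
    -- LOU derivations, from arbitrary terms, are outside-in
    (∀ (t u : LSC.Term) (ρ : List LSC.Step),
      LSC.IsDerivation LSC.IsLOU t ρ u → LSC.IsOutsideIn ρ) ∧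
    -- the subterm property and an outside-in suffix imply local boundedness
    (∀ (t u r : LSC.Term) (ρ σ : List LSC.Step), t.IsLambda →
      LSC.IsDerivation LSC.IsStep t ρ u → LSC.IsDerivation LSC.IsStep u σ r → LSC.AllLs σ →
      LSC.SubtermProperty t (ρ ++ σ) → LSC.IsOutsideIn σ →
      σ.length ≤ LSC.dBCount (ρ ++ σ)) ∧
    -- local boundedness of LOU derivations starting on lambda-terms
    (∀ (t u r : LSC.Term) (ρ σ : List LSC.Step), t.IsLambda →
      LSC.IsDerivation LSC.IsLOU t ρ u → LSC.IsDerivation LSC.IsLOU u σ r → LSC.AllLs σ →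
      σ.length ≤ LSC.dBCount ρ) ∧
    -- quadratic overhead with respect to the unfolded leftmost-outermost beta-derivation
    (∀ (t u : LSC.Term) (ρ : List LSC.Step), t.IsLambda →
      LSC.IsDerivation LSC.IsLOU t ρ u →
      LSC.LOBetaSteps (LSC.dBCount ρ) t u.unfold ∧
      ρ.length ≤ LSC.dBCount ρ + LSC.dBCount ρ ^ 2) := by
  refine ⟨fun t u ρ h => h.isOutsideIn, fun t u r ρ σ ht hρ hσ hls h hoi =>
    h.length_le_dBCount ht hρ hσ hls hoi, fun t u r ρ σ ht hρ hσ hls =>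
    hρ.length_le_dBCount ht hσ hls, fun t u ρ ht h => ⟨?_, ?_⟩⟩
  · simpa only [ht.unfold_eq] using h.loBetaSteps
  · exact LSC.IsDerivation.length_append_le (σ := []) ht ρ (by simpa using h) (by simp [LSC.AllLs])
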